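/- Let $k$ be an infinite field, and for $m\ge 0$ let $S(m)=k[x_1,\ldots,x_m]$ be the standard graded polynomial ring in $m$ variables; put $S=S(n)$. If $l=c_1x_1+\cdots+c_mx_m$ is a linear form in $S(m)$ with $c_m\neq 0$, let $\pi_l\colon S(m)\to S(m)/(l)\cong S(m-1)$ be the projection, where the isomorphism is the inverse of the one induced by the inclusion $S(m-1)\hookrightarrow S(m)$. For linear forms $l_1,\ldots,l_s\in S$ put $\Pi_{l_1\ldots l_s}=\pi_{\overline{l_s}}\cdots\pi_{\overline{l_2}}\,\pi_{l_1}\colon S\to S(n-s)$, where $\overline{l_i}$ is the image of $l_i$ under $\Pi_{l_1\ldots l_{i-1}}$; this is defined if at every step the coefficient of the last variable is nonzero. For a proper homogeneous ideal $I\subset S(m)$ with $D=\dim S(m)/I$ (Krull dimension), write the Hilbert series as $\sum_{j\ge 0}\dim_k\big((S(m)/I)_j\big)\,t^j=q(t)/(1-t)^{D}$ with $q(t)\in\mathbb Z[t]$, and define the Hilbert coefficients $e_i(S(m)/I)\in\mathbb Z$ by $q(t)=\sum_{i\ge 0}e_i(S(m)/I)\,(t-1)^i$. Let $\operatorname{depth}(S/I)$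 be the supremum of the lengths of $S/I$-regular sequences contained in $(x_1,\ldots,x_n)$. Let $P$ be a homogeneous prime ideal of $S$ with $\dim(S/P)=d$, let $1\le s\le d$, and let $r=n-s$. Then for $s$ general linear forms $l_1,\ldots,l_s$ in $S$ (that is, for all $s$-tuples of linear forms whose coefficient vectors lie in some nonempty Zariski open subset, depending on $P$ and $s$, of $(k^n)^s$) the map $\Pi_{l_1\ldots l_s}$ is defined, and with $P_s=\Pi_{l_1\ldots l_s}(P)\subset S(r)$ the following hold. (1) $e_i(S/P)=e_i(S(r)/P_s)$ for all $0\le i\le d-s-1$. (2) If $e_{d-s}(S/P)=e_{d-s}(S(r)/P_s)-(-1)^{d-s}$, then $\operatorname{depth}(S/P)=n-r-1=s-1$. -/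

import Mathlib

open MvPolynomial

noncomputable section

namespace HilbertDepth

variable {k : Type*} [Field k]

/-- The linear form `a₁ x₁ + ⋯ + aₙ xₙ` with coefficient vector `a`. -/
def linearForm {n : ℕ} (a : Fin n → k) : MvPolynomial (Fin n) k :=
  ∑ i, C (a i) * X i

/-- The coefficient of `x_i` in `l`. -/
def linCoeff {n : ℕ} (l : MvPolynomial (Fin n) k) (i : Fin n) : k :=
  coeff (Finsupp.single i 1) l

/-- The projection `π_l : S(m+1) → S(m)` along a linear form `l = ∑ cᵢ xᵢ` whose last coefficient
`c` is nonzero: it fixes all variables but the last one, and solves `l = 0` for the last one.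
By `proj_rename`, `proj_self` and `ker_proj` below it is the composite
`S(m+1) → S(m+1)/(l) ≃ S(m)`, the inverse of the isomorphism being induced by the inclusion
`S(m) ↪ S(m+1)`. -/
def proj {m : ℕ} (l : MvPolynomial (Fin (m + 1)) k) :
    MvPolynomial (Fin (m + 1)) k →ₐ[k] MvPolynomial (Fin m) k :=
  aeval (Fin.snoc (α := fun _ => MvPolynomial (Fin m) k) X
    (∑ i : Fin m, C (-(linCoeff l (Fin.last m))⁻¹ * linCoeff l i.castSucc) * X i))

/-- The iterated projection `Π_{l₁ … l_s} : S(r+s) → S(r)`: apply `π_{l₁}`, then continue with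
the images of `l₂, …, l_s` under `π_{l₁}`. -/
def iterProj : (s r : ℕ) → (Fin s → MvPolynomial (Fin (r + s)) k) →
    (MvPolynomial (Fin (r + s)) k →ₐ[k] MvPolynomial (Fin r) k)
  | 0, r, _ => AlgHom.id k (MvPolynomial (Fin r) k)
  | s + 1, r, l =>
    (iterProj s r (fun i => proj (m := r + s) (l 0) (l i.succ))).comp (proj (m := r + s) (l 0))

/-- The condition for `Π_{l₁ … l_s}` to make sense: at each stage the coefficient of the last
variable in the current linear form is nonzero. -/
def IterProjDefined : (s r : ℕ) → (Fin s → MvPolynomial (Fin (r + s)) k) → Prop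
  | 0, _, _ => True
  | s + 1, r, l => linCoeff (l 0) (Fin.last (r + s)) ≠ 0 ∧
      IterProjDefined s r (fun i => proj (m := r + s) (l 0) (l i.succ))

/-- Zariski open subsets of the affine space of `s`-tuples of linear forms in `n` variables,
identified with their coefficients: complements of common zero sets of polynomials. -/
def IsZariskiOpen {s n : ℕ} (U : Set (Fin s → Fin n → k)) : Prop :=
  ∃ F : Set (MvPolynomial (Fin s × Fin n) k),
    U = {a | ∃ f ∈ F, eval (fun p => a p.1 p.2) f ≠ 0}

/-- The property `Q` holds for `s` general linear forms in `n` variables: it holds on a nonempty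
Zariski open set of `s`-tuples of linear forms. -/
def ForGeneralLinearForms (s n : ℕ) (Q : (Fin s → MvPolynomial (Fin n) k) → Prop) : Prop :=
  ∃ U : Set (Fin s → Fin n → k), IsZariskiOpen U ∧ U.Nonempty ∧
    ∀ a ∈ U, Q (fun j => linearForm (a j))

attribute [local instance] MvPolynomial.gradedAlgebra in
/-- `I` is a homogeneous ideal for the standard grading of the polynomial ring. -/
def IsHomogeneousIdeal {n : ℕ} (I : Ideal (MvPolynomial (Fin n) k)) : Prop :=
  I.IsHomogeneous (homogeneousSubmodule (Fin n) k)

/-- The Hilbert function of the standard graded algebra `S/I`: `m ↦ dim_k (S/I)_m`, where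
`(S/I)_m` is the image of the space of forms of degree `m`. -/
def hilbertFunction {n : ℕ} (I : Ideal (MvPolynomial (Fin n) k)) (m : ℕ) : ℕ :=
  Module.finrank k
    ((homogeneousSubmodule (Fin n) k m).map (Ideal.Quotient.mkₐ k I).toLinearMap)

/-- The Hilbert series of `S/I`. -/
def hilbertSeries {n : ℕ} (I : Ideal (MvPolynomial (Fin n) k)) : PowerSeries ℤ :=
  PowerSeries.mk fun m => (hilbertFunction I m : ℤ)

/-- The Krull dimension of `S/I` as a natural number (`0` if `I` is the unit ideal). -/
def quotientDim {n : ℕ} (I : Ideal (MvPolynomial (Fin n) k)) : ℕ :=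
  ((ringKrullDim (MvPolynomial (Fin n) k ⧸ I)).unbotD 0).toNat

open Classical in
/-- The polynomial `q(t) = h(t) (1 - t) ^ dim (S/I) ∈ ℤ[t]`, where `h` is the Hilbert series of
`S/I`. By the Hilbert-Serre theorem this power series is a polynomial if `I` is homogeneous. -/
def hilbertNumerator {n : ℕ} (I : Ideal (MvPolynomial (Fin n) k)) : Polynomial ℤ :=
  if h : ∃ q : Polynomial ℤ,
      (q : PowerSeries ℤ) = hilbertSeries I * (1 - PowerSeries.X) ^ quotientDim I
  then h.choose else 0

/-- The `i`-th Hilbert coefficient `e_i(S/I)`: the coefficient of `(t - 1) ^ i` in the expansion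
of `q(t)` in powers of `t - 1`. -/
def hilbertCoeff {n : ℕ} (I : Ideal (MvPolynomial (Fin n) k)) (i : ℕ) : ℤ :=
  (Polynomial.taylor 1 (hilbertNumerator I)).coeff i

/-- The depth of `S/I` with respect to the homogeneous maximal ideal `(x₁, …, xₙ)`: the supremum
of the lengths of the `S/I`-regular sequences contained in `(x₁, …, xₙ)`. -/
def depthQuotient {n : ℕ} (I : Ideal (MvPolynomial (Fin n) k)) : ℕ∞ :=
  ⨆ rs : {rs : List (MvPolynomial (Fin n) k) //
      RingTheory.Sequence.IsRegular (MvPolynomial (Fin n) k ⧸ I) rs ∧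
        ∀ f ∈ rs, f ∈ idealOfVars (Fin n) k},
    (rs.1.length : ℕ∞)

lemma linCoeff_linearForm {n : ℕ} (a : Fin n → k) (i : Fin n) :
    linCoeff (linearForm a) i = a i := by
  classical
  simp [linCoeff, linearForm, coeff_sum, coeff_C_mul, coeff_X, Finsupp.single_left_inj]

lemma proj_rename {m : ℕ} (l : MvPolynomial (Fin (m + 1)) k) (f : MvPolynomial (Fin m) k) :
    proj l (rename Fin.castSucc f) = f := by
  have h : (Fin.snoc (α := fun _ => MvPolynomial (Fin m) k) X
    (∑ i : Fin m, C (-(linCoeff l (Fin.last m))⁻¹ * linCoeff l i.castSucc) * X i)) ∘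
      Fin.castSucc = X := by
    funext i; simp
  rw [proj, aeval_rename, h, aeval_X_left_apply]

lemma proj_self {m : ℕ} (a : Fin (m + 1) → k) (ha : a (Fin.last m) ≠ 0) :
    proj (linearForm a) (linearForm a) = 0 := by
  simp only [proj, linCoeff_linearForm]
  rw [linearForm, Fin.sum_univ_castSucc]
  simp only [map_add, map_sum, map_mul, aeval_X, algHom_C, Fin.snoc_castSucc, Fin.snoc_last,
    Finset.mul_sum, ← Finset.sum_add_distrib, algebraMap_eq]
  refine Finset.sum_eq_zero fun i _ => ?_
  rw [← mul_assoc, ← C_mul, ← C_mul, ← add_mul, ← map_add C]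
  rw [show a i.castSucc + a (Fin.last m) * (-(a (Fin.last m))⁻¹ * a i.castSucc) = 0 by
    field_simp; ring]
  simp

lemma ker_proj {m : ℕ} (a : Fin (m + 1) → k) (ha : a (Fin.last m) ≠ 0) :
    RingHom.ker (proj (linearForm a)) = Ideal.span {linearForm a} := by
  refine le_antisymm ?_ ?_
  · have key : (Ideal.Quotient.mkₐ k (Ideal.span {linearForm a})).comp
        ((rename Fin.castSucc).comp (proj (linearForm a))) =
        Ideal.Quotient.mkₐ k (Ideal.span {linearForm a}) := by
      apply algHom_ext
      intro i
      refine Fin.lastCases ?_ (fun j => ?_) i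
      · rw [AlgHom.comp_apply, Ideal.Quotient.mkₐ_eq_mk, Ideal.Quotient.mk_eq_mk_iff_sub_mem,
          Ideal.mem_span_singleton']
        refine ⟨-C (a (Fin.last m))⁻¹, ?_⟩
        simp only [proj, linCoeff_linearForm, AlgHom.comp_apply, aeval_X, Fin.snoc_last, map_sum,
          map_mul, rename_C, rename_X]
        rw [linearForm, Fin.sum_univ_castSucc, mul_add, Finset.mul_sum]
        have h2 : -C (a (Fin.last m))⁻¹ * (C (a (Fin.last m)) * X (Fin.last m)) =
            -(X (Fin.last m) : MvPolynomial (Fin (m + 1)) k) := by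
          rw [← mul_assoc, neg_mul, ← C_mul, inv_mul_cancel₀ ha]
          simp
        rw [h2, sub_eq_add_neg]
        congr 1
        refine Finset.sum_congr rfl fun i _ => ?_
        simp only [map_neg]
        ring
      · simp [proj]
    intro f hf
    have := DFunLike.congr_fun key f
    rw [AlgHom.comp_apply, AlgHom.comp_apply, (RingHom.mem_ker).1 hf] at this
    rw [map_zero, map_zero] at this
    exact Ideal.Quotient.eq_zero_iff_mem.1 this.symm
  · rw [Ideal.span_singleton_le_iff_mem]
    exact proj_self a ha

end HilbertDepth

end

open MvPolynomial

noncomputable section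

namespace HilbertDepth

variable {k : Type*} [Field k]

/-! ### Homogeneous components and homogeneous ideals -/

section Components

variable {n : ℕ}

-- Write `H` for Hilbert series and `J_i = P + (l₁, …, l_i)`. The iterated projection is a graded
-- surjection with kernel `(l₁, …, l_s)`, so `S(r)/P_s ≅ S/J_s`, and everything takes place in `S`.
--
-- General linear forms are filter-regular on `S/P`: each `(J_{i-1} : l_i)/J_{i-1}` is torsion with
-- respect to the variables, hence of finite length (`exists_forall_isFilterRegular`). For generic
-- coefficients this follows by solving the previous forms for the coefficients of one variable
-- `x_j`, which is possible once `x_j` is inverted; generic freeness carries it over to general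
-- coefficients in `k`.
--
-- Multiplication by `l` gives `H(S/(I + l)) = (1 - t) H(S/I) + t T(t)`, where `T` is the Hilbert
-- series of `(I : l)/I`. Iterating, `H(S/J_s) = (1 - t)^s H(S/P) + G(t)` with `G` a polynomial and
-- `G(1)` the length of `(J_{s-1} : l_s)/J_{s-1}`. The dimension drops by exactly `s`, so the
-- numerator changes by `G (1 - t)^(d-s)`. This leaves `e_i` unchanged for `i < d - s` and adds
-- `(-1)^(d-s) G(1)` to `e_{d-s}`. The hypothesis of (2) thus says `G(1) = 1`.
--
-- For (2), regard `S/P` as a module over `A = k[y₁, …, y_s]`, with `y_i` acting as `l_i`. The `l_i`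
-- are algebraically independent modulo the prime `P`, so `S/P` is torsion-free over `A`. Lifting a
-- homogeneous basis of `S/J_s` gives a surjection `F → S/P` from a free module (of finite rank in
-- each degree) whose kernel `Z` has Hilbert series `G/(1 - t)^s`, hence rank `G(1) = 1`. As `Z` is
-- saturated and `A` is factorial, `Z = A w` (`exists_generator_of_saturated`). Because `G(1) ≠ 0`,
-- `l_s` is a zerodivisor modulo `J_{s-1}`. This forces `w ∉ (y₁, …, y_{s-1}) F`, which in turn
-- makes `l₁, …, l_{s-1}` regular on `S/P` (`mem_partialIdeal_of_cyclic_relations`). A nonzero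
-- torsion element modulo this regular sequence bounds the depth from above, by vanishing of `Ext`
-- (`length_le_of_torsion`).

attribute [local instance] MvPolynomial.gradedAlgebra in
lemma isHomogeneousIdeal_iff {I : Ideal (MvPolynomial (Fin n) k)} :
    IsHomogeneousIdeal I ↔ ∀ f ∈ I, ∀ m, homogeneousComponent m f ∈ I := by
  refine ⟨fun h f hf m => homogeneousComponent_mem_of_mem h hf m, fun h => ?_⟩
  intro m f hf
  have := h f hf m
  rwa [← decomposition.decompose'_apply] at this

lemma homogeneousComponent_succ_mul {l : MvPolynomial (Fin n) k} (hl : l.IsHomogeneous 1)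
    (g : MvPolynomial (Fin n) k) (m : ℕ) :
    homogeneousComponent (m + 1) (l * g) = l * homogeneousComponent m g := by
  classical
  conv_lhs => rw [← sum_homogeneousComponent g, Finset.mul_sum, map_sum]
  have key : ∀ i, homogeneousComponent (m + 1) (l * homogeneousComponent i g) =
      if i = m then l * homogeneousComponent m g else 0 := by
    intro i
    rw [homogeneousComponent_of_mem (n := 1 + i)
      (hl.mul (homogeneousComponent_isHomogeneous i g))]
    by_cases h : i = m
    · subst h; simp [add_comm]
    · rw [if_neg (by omega), if_neg h]
  rw [Finset.sum_congr rfl fun i _ => key i]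
  by_cases h : m ≤ g.totalDegree
  · rw [Finset.sum_ite_eq' , if_pos (by simpa [Nat.lt_succ_iff] using h)]
  · rw [homogeneousComponent_eq_zero m g (by omega)]
    simp

lemma homogeneousComponent_zero_mul {l : MvPolynomial (Fin n) k} (hl : l.IsHomogeneous 1)
    (g : MvPolynomial (Fin n) k) : homogeneousComponent 0 (l * g) = 0 := by
  have h : coeff 0 l = 0 := hl.coeff_eq_zero (by simp)
  rw [homogeneousComponent_zero]
  have : coeff 0 (l * g) = 0 := by
    have := congrArg (· * constantCoeff g) h
    simpa [← constantCoeff_eq, map_mul] using this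
  rw [this, map_zero]

/-- The ideal quotient `I : l`. -/
def colonIdeal (I : Ideal (MvPolynomial (Fin n) k)) (l : MvPolynomial (Fin n) k) :
    Ideal (MvPolynomial (Fin n) k) :=
  Submodule.comap (LinearMap.mulLeft (MvPolynomial (Fin n) k) l) I

lemma mem_colonIdeal {I : Ideal (MvPolynomial (Fin n) k)} {l f : MvPolynomial (Fin n) k} :
    f ∈ colonIdeal I l ↔ l * f ∈ I := Iff.rfl

lemma le_colonIdeal (I : Ideal (MvPolynomial (Fin n) k)) (l : MvPolynomial (Fin n) k) :
    I ≤ colonIdeal I l := fun _ hf => I.mul_mem_left l hf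

lemma IsHomogeneousIdeal.colonIdeal {I : Ideal (MvPolynomial (Fin n) k)}
    (hI : IsHomogeneousIdeal I) {l : MvPolynomial (Fin n) k} (hl : l.IsHomogeneous 1) :
    IsHomogeneousIdeal (colonIdeal I l) := by
  rw [isHomogeneousIdeal_iff] at hI ⊢
  intro f hf m
  rw [mem_colonIdeal, ← homogeneousComponent_succ_mul hl]
  exact hI _ hf _

lemma IsHomogeneousIdeal.sup {I J : Ideal (MvPolynomial (Fin n) k)}
    (hI : IsHomogeneousIdeal I) (hJ : IsHomogeneousIdeal J) : IsHomogeneousIdeal (I ⊔ J) := by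
  rw [isHomogeneousIdeal_iff] at hI hJ ⊢
  intro f hf m
  obtain ⟨a, ha, b, hb, rfl⟩ := Submodule.mem_sup.1 hf
  rw [map_add]
  exact add_mem (Ideal.mem_sup_left (hI a ha m)) (Ideal.mem_sup_right (hJ b hb m))

lemma isHomogeneousIdeal_span {s : Set (MvPolynomial (Fin n) k)}
    (hs : ∀ l ∈ s, l.IsHomogeneous 1) : IsHomogeneousIdeal (Ideal.span s) := by
  rw [isHomogeneousIdeal_iff]
  intro f hf
  refine Submodule.span_induction ?_ ?_ ?_ ?_
    (p := fun f _ => ∀ m, homogeneousComponent m f ∈ Ideal.span s)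
    (show f ∈ Submodule.span _ s from hf)
  · intro x hx m
    rw [homogeneousComponent_of_mem (hs x hx)]
    split_ifs
    · exact Ideal.subset_span hx
    · exact zero_mem _
  · simp
  · intro x y _ _ hx hy m
    rw [map_add]
    exact add_mem (hx m) (hy m)
  · intro a x hx' hx m
    suffices H : ∀ (a x : MvPolynomial (Fin n) k),
        (∀ m, homogeneousComponent m x ∈ Ideal.span s) →
        ∀ m, homogeneousComponent m (a * x) ∈ Ideal.span s from H a x hx m
    clear hx' hx m a x
    intro a
    induction a using MvPolynomial.induction_on with
    | C c => intro x hx m; rw [homogeneousComponent_C_mul]; exact Ideal.mul_mem_left _ _ (hx m)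
    | add p q hp hq =>
      intro x hx m
      rw [add_mul, map_add]; exact add_mem (hp x hx m) (hq x hx m)
    | mul_X p i hp =>
      intro x hx m
      rw [mul_assoc]
      refine hp _ ?_ m
      rintro (_ | m)
      · rw [homogeneousComponent_zero_mul (isHomogeneous_X k i)]; exact zero_mem _
      · rw [homogeneousComponent_succ_mul (isHomogeneous_X k i)]
        exact Ideal.mul_mem_left _ _ (hx m)

end Components

/-! ### Hilbert functions and multiplication by a linear form -/

section HilbertFunction

variable {n : ℕ}

instance finiteDimensional_homogeneousSubmodule (m : ℕ) :
    FiniteDimensional k (homogeneousSubmodule (Fin n) k m) :=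
  Module.Finite.iff_fg.2 (homogeneousSubmodule_fg (Fin n) k m)

lemma finrank_map_mk_add (I : Ideal (MvPolynomial (Fin n) k))
    (U : Submodule k (MvPolynomial (Fin n) k)) [FiniteDimensional k U] :
    Module.finrank k (U.map (Ideal.Quotient.mkₐ k I).toLinearMap) +
      Module.finrank k (U ⊓ I.restrictScalars k : Submodule k _) = Module.finrank k U := by
  have h := LinearMap.finrank_range_add_finrank_ker
    ((Ideal.Quotient.mkₐ k I).toLinearMap.domRestrict U)
  rw [LinearMap.range_domRestrict] at h
  rw [← h]
  congr 1
  have h2 : (U ⊓ I.restrictScalars k : Submodule k _) =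
      (LinearMap.ker ((Ideal.Quotient.mkₐ k I).toLinearMap.domRestrict U)).map U.subtype := by
    ext f
    simp [Ideal.Quotient.eq_zero_iff_mem, and_comm]
  rw [h2]
  exact (LinearEquiv.finrank_eq (Submodule.equivMapOfInjective _ U.injective_subtype _)).symm

lemma hilbertFunction_add (I : Ideal (MvPolynomial (Fin n) k)) (m : ℕ) :
    hilbertFunction I m + Module.finrank k
      (homogeneousSubmodule (Fin n) k m ⊓ I.restrictScalars k : Submodule k _) =
      Module.finrank k (homogeneousSubmodule (Fin n) k m) :=
  finrank_map_mk_add I _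

lemma hilbertFunction_congr {I J : Ideal (MvPolynomial (Fin n) k)} {m : ℕ}
    (h : ∀ f : MvPolynomial (Fin n) k, f.IsHomogeneous m → (f ∈ I ↔ f ∈ J)) :
    hilbertFunction I m = hilbertFunction J m := by
  have h1 := hilbertFunction_add I m
  have h2 := hilbertFunction_add J m
  have : (homogeneousSubmodule (Fin n) k m ⊓ I.restrictScalars k : Submodule k _) =
      (homogeneousSubmodule (Fin n) k m ⊓ J.restrictScalars k : Submodule k _) := by
    ext f
    simp only [Submodule.mem_inf, mem_homogeneousSubmodule, Submodule.restrictScalars_mem]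
    exact and_congr_right fun hf => h f hf
  rw [this] at h1
  omega

lemma hilbertFunction_eq_zero {I : Ideal (MvPolynomial (Fin n) k)} {m : ℕ}
    (h : ∀ f : MvPolynomial (Fin n) k, f.IsHomogeneous m → f ∈ I) : hilbertFunction I m = 0 := by
  have h1 := hilbertFunction_add I m
  have : (homogeneousSubmodule (Fin n) k m ⊓ I.restrictScalars k : Submodule k _) =
      homogeneousSubmodule (Fin n) k m := inf_eq_left.2 fun f hf => h f hf
  rw [this] at h1
  omega

lemma mem_sup_span_singleton_homogeneous {I : Ideal (MvPolynomial (Fin n) k)}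
    (hI : IsHomogeneousIdeal I) {l : MvPolynomial (Fin n) k} (hl : l.IsHomogeneous 1) {m : ℕ}
    {f : MvPolynomial (Fin n) k} (hf : f.IsHomogeneous (m + 1)) :
    f ∈ I ⊔ Ideal.span {l} ↔ ∃ g : MvPolynomial (Fin n) k, g.IsHomogeneous m ∧ f - l * g ∈ I := by
  constructor
  · intro h
    obtain ⟨a, ha, b, hb, hab⟩ := Submodule.mem_sup.1 h
    obtain ⟨c, rfl⟩ := Ideal.mem_span_singleton'.1 hb
    refine ⟨homogeneousComponent m c, homogeneousComponent_isHomogeneous _ _, ?_⟩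
    have := isHomogeneousIdeal_iff.1 hI a ha (m + 1)
    convert this using 1
    rw [← homogeneousComponent_succ_mul hl, ← homogeneousComponent_eq_self hf, ← map_sub, ← hab]
    congr 1
    ring
  · rintro ⟨g, -, h⟩
    have : f = (f - l * g) + g * l := by ring
    rw [this]
    exact add_mem (Ideal.mem_sup_left h)
      (Ideal.mem_sup_right (Ideal.mul_mem_left _ _ (Ideal.mem_span_singleton_self l)))

/-- Dimension count in degree `m + 1` for the exact sequence `0 → (S/(I : l))(-1) → S/I → S/(I + l)
→ 0`, whose first map is multiplication by `l`. -/
lemma hilbertFunction_succ {I : Ideal (MvPolynomial (Fin n) k)}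
    (hI : IsHomogeneousIdeal I) {l : MvPolynomial (Fin n) k} (hl : l.IsHomogeneous 1) (m : ℕ) :
    hilbertFunction I (m + 1) =
      hilbertFunction (colonIdeal I l) m + hilbertFunction (I ⊔ Ideal.span {l}) (m + 1) := by
  set K := I ⊔ Ideal.span {l} with hK
  set Q := (Ideal.Quotient.mkₐ k I).toLinearMap with hQ
  set U := (homogeneousSubmodule (Fin n) k (m + 1) ⊓ K.restrictScalars k : Submodule k _) with hU
  -- the image of `U` in `S / I` is the image of multiplication by `l`
  set μ := Q ∘ₗ LinearMap.mulLeft k l with hμ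
  have himg : U.map Q = (homogeneousSubmodule (Fin n) k m).map μ := by
    ext x
    simp only [Submodule.mem_map]
    constructor
    · rintro ⟨f, ⟨hf, hfK⟩, rfl⟩
      obtain ⟨g, hg, hfg⟩ := (mem_sup_span_singleton_homogeneous hI hl hf).1 hfK
      refine ⟨g, hg, ?_⟩
      exact (Ideal.Quotient.eq.2 hfg).symm
    · rintro ⟨g, hg, rfl⟩
      refine ⟨l * g, ⟨?_, ?_⟩, rfl⟩
      · have := hl.mul hg
        rwa [add_comm] at this
      · exact Ideal.mem_sup_right (Ideal.mul_mem_right _ _ (Ideal.mem_span_singleton_self l))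
  have h1 := finrank_map_mk_add I U
  have h2 := hilbertFunction_add I (m + 1)
  have h3 := hilbertFunction_add K (m + 1)
  have h4 := hilbertFunction_add (colonIdeal I l) m
  have h5 : U ⊓ I.restrictScalars k =
      (homogeneousSubmodule (Fin n) k (m + 1) ⊓ I.restrictScalars k : Submodule k _) := by
    ext f
    simp only [hU, Submodule.mem_inf, Submodule.restrictScalars_mem]
    exact ⟨fun h => ⟨h.1.1, h.2⟩, fun h => ⟨⟨h.1, Ideal.mem_sup_left h.2⟩, h.2⟩⟩
  have h6 := LinearMap.finrank_range_add_finrank_ker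
    (μ.domRestrict (homogeneousSubmodule (Fin n) k m))
  rw [LinearMap.range_domRestrict, ← himg] at h6
  have h7 : (homogeneousSubmodule (Fin n) k m ⊓ (colonIdeal I l).restrictScalars k :
      Submodule k _) =
      (LinearMap.ker (μ.domRestrict (homogeneousSubmodule (Fin n) k m))).map
        (Submodule.subtype _) := by
    ext f
    simp only [Submodule.mem_inf, Submodule.restrictScalars_mem, mem_homogeneousSubmodule,
      mem_colonIdeal, hμ, hQ, Submodule.mem_map, LinearMap.mem_ker, LinearMap.domRestrict_apply,
      Subtype.exists, Submodule.subtype_apply, exists_and_right, exists_eq_right,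
      LinearMap.comp_apply, LinearMap.mulLeft_apply, AlgHom.toLinearMap_apply,
      Ideal.Quotient.mkₐ_eq_mk, Ideal.Quotient.eq_zero_iff_mem, exists_prop]
  rw [h7, ← LinearEquiv.finrank_eq (Submodule.equivMapOfInjective _
    (Submodule.injective_subtype _) _)] at h4
  rw [h5, ← hQ] at h1
  rw [← hU] at h3
  omega

lemma hilbertFunction_zero_sup {I : Ideal (MvPolynomial (Fin n) k)}
    (hI : IsHomogeneousIdeal I) {l : MvPolynomial (Fin n) k} (hl : l.IsHomogeneous 1) :
    hilbertFunction I 0 = hilbertFunction (I ⊔ Ideal.span {l}) 0 := by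
  refine hilbertFunction_congr fun f hf => ⟨fun h => Ideal.mem_sup_left h, fun h => ?_⟩
  obtain ⟨a, ha, b, hb, hab⟩ := Submodule.mem_sup.1 h
  obtain ⟨c, rfl⟩ := Ideal.mem_span_singleton'.1 hb
  have := isHomogeneousIdeal_iff.1 hI a ha 0
  rwa [← homogeneousComponent_eq_self hf, ← hab, map_add, mul_comm,
    homogeneousComponent_zero_mul hl, add_zero]

lemma hilbertSeries_eq {I : Ideal (MvPolynomial (Fin n) k)}
    (hI : IsHomogeneousIdeal I) {l : MvPolynomial (Fin n) k} (hl : l.IsHomogeneous 1) :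
    hilbertSeries I = PowerSeries.X * hilbertSeries (colonIdeal I l) +
      hilbertSeries (I ⊔ Ideal.span {l}) := by
  ext (_ | m)
  · simp [hilbertSeries, hilbertFunction_zero_sup hI hl]
  · simp [hilbertSeries, hilbertFunction_succ hI hl m, PowerSeries.coeff_succ_X_mul]

end HilbertFunction

/-! ### Integer power series and their poles at `1` -/

section Series

lemma mk_sum_range_mul (f : ℕ → ℤ) :
    (PowerSeries.mk fun m => ∑ j ∈ Finset.range (m + 1), f j) * (1 - PowerSeries.X) =
      PowerSeries.mk f := by
  ext (_ | m)
  · simp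
  · rw [mul_sub, mul_one, map_sub, PowerSeries.coeff_succ_mul_X]
    simp [Finset.sum_range_succ _ (m + 1)]

/-- Dividing by `1 - X` forms partial sums, and partial sums of integers that are eventually at most
`-1` tend to `-∞`. -/
lemma eventually_coeff_le_of_mul_one_sub {A B : PowerSeries ℤ}
    (h : A * (1 - PowerSeries.X) = B) (hB : ∃ N, ∀ m, N ≤ m → PowerSeries.coeff m B ≤ -1) :
    ∃ N, ∀ m, N ≤ m → PowerSeries.coeff m A ≤ -1 := by
  obtain ⟨N, hN⟩ := hB
  have hrec : ∀ m, PowerSeries.coeff (m + 1) A =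
      PowerSeries.coeff m A + PowerSeries.coeff (m + 1) B := by
    intro m
    rw [← h, mul_sub, mul_one, map_sub, PowerSeries.coeff_succ_mul_X]
    ring
  have hlin : ∀ j, PowerSeries.coeff (N + j) A ≤ PowerSeries.coeff N A - j := by
    intro j
    induction j with
    | zero => simp
    | succ j ih =>
      have h1 := hN (N + j + 1) (by omega)
      rw [← add_assoc, hrec]
      push_cast
      linarith
  refine ⟨N + (PowerSeries.coeff N A + 1).toNat, fun m hm => ?_⟩
  obtain ⟨j, rfl⟩ := Nat.exists_eq_add_of_le (Nat.le_of_add_right_le hm)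
  have h1 := hlin j
  have h2 := Int.self_le_toNat (PowerSeries.coeff N A + 1)
  have h3 : ((PowerSeries.coeff N A + 1).toNat : ℤ) ≤ j := by exact_mod_cast (by omega)
  linarith

/-- If the coefficients of `g / (1 - X) ^ D` are nonnegative, then `g(1) ≥ 0`. -/
lemma eval_one_nonneg_of_coeff_nonneg (g : Polynomial ℤ) (D : ℕ) (H : PowerSeries ℤ)
    (hH : H * (1 - PowerSeries.X) ^ D = (g : PowerSeries ℤ))
    (hpos : ∀ m, 0 ≤ PowerSeries.coeff m H) : 0 ≤ g.eval 1 := by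
  by_contra! hneg
  have heval : ∀ m, g.natDegree ≤ m → ∑ j ∈ Finset.range (m + 1), g.coeff j = g.eval 1 := by
    intro m hm
    rw [Polynomial.eval_eq_sum_range' (Nat.lt_succ_of_le hm)]
    simp
  rcases D with _ | D
  · have h1 := heval g.natDegree le_rfl
    have h2 : 0 ≤ ∑ j ∈ Finset.range (g.natDegree + 1), g.coeff j := by
      refine Finset.sum_nonneg fun j _ => ?_
      rw [← Polynomial.coeff_coe, ← hH, pow_zero, mul_one]
      exact hpos j
    linarith
  -- After one division by `1 - X` the coefficients are eventually the constant `g(1) ≤ -1`. Each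
  -- further division keeps them eventually negative, until `H` itself is reached.
  · have hind : ∀ i ≤ D, ∃ N, ∀ m, N ≤ m →
        PowerSeries.coeff m (H * (1 - PowerSeries.X) ^ (D - i)) ≤ -1 := by
      intro i
      induction i with
      | zero =>
        intro _
        refine ⟨g.natDegree, fun m hm => ?_⟩
        have h1 : H * (1 - PowerSeries.X) ^ D =
            PowerSeries.mk fun m => ∑ j ∈ Finset.range (m + 1), g.coeff j := by
          have hne : (1 - PowerSeries.X : PowerSeries ℤ) ≠ 0 := by
            intro h0
            have := congrArg (PowerSeries.coeff 0) h0
            simp at this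
          apply mul_right_cancel₀ hne
          rw [mk_sum_range_mul, mul_assoc, ← pow_succ, hH]
          ext j
          simp
        rw [Nat.sub_zero, h1, PowerSeries.coeff_mk, heval m hm]
        omega
      | succ i ih =>
        intro hi
        refine eventually_coeff_le_of_mul_one_sub ?_ (ih (by omega))
        rw [mul_assoc, ← pow_succ, show D - (i + 1) + 1 = D - i by omega]
    obtain ⟨N, hN⟩ := hind D le_rfl
    have h1 := hN N le_rfl
    rw [Nat.sub_self, pow_zero, mul_one] at h1
    linarith [hpos N]

lemma mk_multichoose_mul (s : ℕ) :
    (PowerSeries.mk fun m => (Nat.multichoose s m : ℤ)) * (1 - PowerSeries.X) ^ s = 1 := by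
  induction s with
  | zero =>
    ext (_ | m)
    · simp
    · simp [Nat.multichoose_zero_succ, PowerSeries.coeff_one]
  | succ s ih =>
    have h : (PowerSeries.mk fun m => (Nat.multichoose (s + 1) m : ℤ)) * (1 - PowerSeries.X) =
        PowerSeries.mk fun m => (Nat.multichoose s m : ℤ) := by
      ext (_ | m)
      · simp
      · rw [mul_sub, mul_one, map_sub, PowerSeries.coeff_succ_mul_X]
        simp [Nat.multichoose_succ_succ]
    rw [pow_succ', ← mul_assoc, h, ih]

lemma exists_polynomial_of_eventually_zero (f : ℕ → ℤ) (N : ℕ) (h : ∀ m, N ≤ m → f m = 0) :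
    (((PowerSeries.mk f).trunc N : Polynomial ℤ) : PowerSeries ℤ) = PowerSeries.mk f := by
  ext m
  rw [Polynomial.coeff_coe, PowerSeries.coeff_trunc]
  split_ifs with hm
  · rfl
  · simp [h m (not_lt.1 hm)]

end Series

/-! ### Quotients of finite length, Hilbert-Serre and graded Nakayama -/

section Params

variable {n : ℕ}

/-- The quotient by `I` has finite length: the ideal of the variables is in the radical. -/
def IsIrrelevant (I : Ideal (MvPolynomial (Fin n) k)) : Prop :=
  ∀ j, X j ∈ I.radical

lemma IsIrrelevant.mono {I J : Ideal (MvPolynomial (Fin n) k)} (hI : IsIrrelevant I)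
    (h : I ≤ J) : IsIrrelevant J := fun j => Ideal.radical_mono h (hI j)

lemma isHomogeneous_mem_pow_idealOfVars {f : MvPolynomial (Fin n) k} {m N : ℕ}
    (hf : f.IsHomogeneous m) (h : N ≤ m) : f ∈ idealOfVars (Fin n) k ^ N := by
  rw [mem_pow_idealOfVars_iff']
  intro x hx
  exact hf.coeff_eq_zero (by omega)

lemma exists_pow_idealOfVars_le {I : Ideal (MvPolynomial (Fin n) k)} (hI : IsIrrelevant I) :
    ∃ N, idealOfVars (Fin n) k ^ N ≤ I := by
  refine Ideal.exists_pow_le_of_le_radical_of_fg ?_ (idealOfVars_fg _ _)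
  rw [idealOfVars, Ideal.span_le]
  rintro _ ⟨j, rfl⟩
  exact hI j

lemma IsIrrelevant.exists_forall_mem {I : Ideal (MvPolynomial (Fin n) k)} (hI : IsIrrelevant I) :
    ∃ N, ∀ m, N ≤ m → ∀ f : MvPolynomial (Fin n) k, f.IsHomogeneous m → f ∈ I := by
  obtain ⟨N, hN⟩ := exists_pow_idealOfVars_le hI
  exact ⟨N, fun m hm f hf => hN (isHomogeneous_mem_pow_idealOfVars hf hm)⟩

/-- If the colon ideal `I : l` differs from `I` only by torsion with respect to the variables,
then both agree in large degrees. -/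
lemma exists_forall_mem_of_torsion {I K : Ideal (MvPolynomial (Fin n) k)}
    (hI : IsHomogeneousIdeal I) (h : ∀ f ∈ K, ∀ j, ∃ N, X j ^ N * f ∈ I) :
    ∃ N, ∀ m, N ≤ m → ∀ f : MvPolynomial (Fin n) k, f.IsHomogeneous m → f ∈ K → f ∈ I := by
  classical
  obtain ⟨t, rfl⟩ : K.FG := IsNoetherian.noetherian K
  have h1 : ∀ g ∈ t, ∃ N, idealOfVars (Fin n) k ^ N ≤ colonIdeal I g := by
    intro g hg
    refine exists_pow_idealOfVars_le fun j => ?_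
    obtain ⟨N, hN⟩ := h g (Submodule.subset_span hg) j
    exact ⟨N, by rwa [mem_colonIdeal, mul_comm]⟩
  choose! N hN using h1
  set M := t.sup N
  set D := t.sup totalDegree
  refine ⟨M + D + 1, fun m hm f hf hfK => ?_⟩
  obtain ⟨c, hc, rfl⟩ := Submodule.mem_span_finset.1 hfK
  have key : ∀ g ∈ t, homogeneousComponent m (c g • g) ∈ I := by
    intro g hg
    -- Degree is split at `M`: the high part of the coefficient multiplies `g` into `I`, while the
    -- low part times `g` has degree at most `M + D` and does not reach degree `m`.
    set low : MvPolynomial (Fin n) k := ∑ i ∈ Finset.range M, homogeneousComponent i (c g)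
    have hhigh : c g - low ∈ idealOfVars (Fin n) k ^ M := by
      rw [mem_pow_idealOfVars_iff']
      intro x hx
      simp only [low, coeff_sub, coeff_sum, coeff_homogeneousComponent]
      rw [Finset.sum_ite_eq, if_pos (by simpa using hx), sub_self]
    have hlow : low.totalDegree ≤ M := by
      refine (totalDegree_finsetSum _ _).trans (Finset.sup_le fun i hi => ?_)
      exact (homogeneousComponent_isHomogeneous i _).totalDegree_le.trans
        (Finset.mem_range.1 hi).le
    have e : c g • g = g * (c g - low) + low * g := by rw [smul_eq_mul]; ring
    rw [e, map_add, homogeneousComponent_eq_zero m (low * g), add_zero]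
    · refine isHomogeneousIdeal_iff.1 hI _ ?_ m
      exact hN g hg (Ideal.pow_le_pow_right (Finset.le_sup hg) hhigh)
    · have h2 : g.totalDegree ≤ D := Finset.le_sup hg
      have h3 := totalDegree_mul low g
      omega
  rw [← homogeneousComponent_eq_self hf, map_sum]
  exact sum_mem fun g hg => key g hg

lemma hilbertSeries_polynomial_of_isIrrelevant {I : Ideal (MvPolynomial (Fin n) k)}
    (hI : IsIrrelevant I) : ∃ q : Polynomial ℤ, (q : PowerSeries ℤ) = hilbertSeries I := by
  obtain ⟨N, hN⟩ := hI.exists_forall_mem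
  refine ⟨_, exists_polynomial_of_eventually_zero _ N fun m hm => ?_⟩
  rw [hilbertFunction_eq_zero (hN m hm), Nat.cast_zero]

/-- The Hilbert-Serre theorem. -/
theorem hilbert_serre (D : ℕ) : ∀ (I : Ideal (MvPolynomial (Fin n) k)),
    IsHomogeneousIdeal I → ∀ y : Fin D → MvPolynomial (Fin n) k, (∀ j, (y j).IsHomogeneous 1) →
    IsIrrelevant (I ⊔ Ideal.span (Set.range y)) →
    ∃ q : Polynomial ℤ, (q : PowerSeries ℤ) = hilbertSeries I * (1 - PowerSeries.X) ^ D := by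
  induction D with
  | zero =>
    intro I _ y _ h
    obtain ⟨q, hq⟩ := hilbertSeries_polynomial_of_isIrrelevant
      (I := I) (by simpa [Set.range_eq_empty] using h)
    exact ⟨q, by simpa using hq⟩
  | succ D ih =>
    intro I hI y hy h
    have hstep : ∀ J : Ideal (MvPolynomial (Fin n) k), IsHomogeneousIdeal J → I ≤ J →
        ∃ q : Polynomial ℤ, (q : PowerSeries ℤ) =
          hilbertSeries (J ⊔ Ideal.span {y 0}) * (1 - PowerSeries.X) ^ D := by
      intro J hJ hIJ
      refine ih _ (hJ.sup (isHomogeneousIdeal_span ?_)) (fun j => y j.succ) (fun j => hy _)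
        (h.mono ?_)
      · rintro _ rfl; exact hy 0
      · refine sup_le (hIJ.trans (le_sup_left.trans le_sup_left)) (Ideal.span_le.2 ?_)
        rintro _ ⟨j, rfl⟩
        refine Fin.cases ?_ (fun j => ?_) j
        · exact Ideal.mem_sup_left (Ideal.mem_sup_right (Ideal.mem_span_singleton_self _))
        · exact Ideal.mem_sup_right (Ideal.subset_span ⟨j, rfl⟩)
    -- the chain of the ideals `I : y₀ ^ e`
    set c : ℕ → Ideal (MvPolynomial (Fin n) k) := fun e => (colonIdeal · (y 0))^[e] I with hc
    have hcs : ∀ e, c (e + 1) = colonIdeal (c e) (y 0) := fun e =>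
      Function.iterate_succ_apply' _ _ _
    have hmono : Monotone c := monotone_nat_of_le_succ fun e => by
      rw [hcs]; exact le_colonIdeal _ _
    have hchom : ∀ e, IsHomogeneousIdeal (c e) := by
      intro e
      induction e with
      | zero => exact hI
      | succ e ihe => rw [hcs]; exact ihe.colonIdeal (hy 0)
    obtain ⟨E, hE⟩ := monotone_stabilizes_iff_noetherian.2
      (inferInstance : IsNoetherian (MvPolynomial (Fin n) k) (MvPolynomial (Fin n) k)) ⟨c, hmono⟩
    have hE' : c E = c (E + 1) := hE (E + 1) (Nat.le_succ E)
    -- Descending induction along the chain. At the stable ideal `y₀` is a nonzerodivisor, so the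
    -- series is that of the quotient by `y₀` divided by `1 - t`; below it, the colon ideal is the
    -- next member of the chain.
    have key : ∀ i, ∃ q : Polynomial ℤ, (q : PowerSeries ℤ) =
        hilbertSeries (c (E - i)) * (1 - PowerSeries.X) ^ (D + 1) := by
      intro i
      induction i with
      | zero =>
        obtain ⟨q, hq⟩ := hstep (c E) (hchom E) (hmono (Nat.zero_le E))
        refine ⟨q, ?_⟩
        have := hilbertSeries_eq (hchom E) (hy 0)
        rw [← hcs, ← hE'] at this
        rw [hq, Nat.sub_zero, pow_succ']
        linear_combination (- (1 - PowerSeries.X) ^ D) * this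
      | succ i ihi =>
        by_cases hi : E ≤ i
        · rw [Nat.sub_eq_zero_of_le (by omega)]
          rwa [Nat.sub_eq_zero_of_le hi] at ihi
        · obtain ⟨q, hq⟩ := hstep (c (E - (i + 1))) (hchom _) (hmono (Nat.zero_le _))
          obtain ⟨q', hq'⟩ := ihi
          refine ⟨Polynomial.X * q' + q * (1 - Polynomial.X), ?_⟩
          have := hilbertSeries_eq (hchom (E - (i + 1))) (hy 0)
          rw [← hcs, show E - (i + 1) + 1 = E - i by omega] at this
          rw [this]
          push_cast
          rw [hq, hq']
          ring
    have := key E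
    rwa [Nat.sub_self] at this

/-- Graded Nakayama lemma. -/
lemma graded_nakayama {I : Ideal (MvPolynomial (Fin n) k)} (hI : IsHomogeneousIdeal I) {D : ℕ}
    {y : Fin D → MvPolynomial (Fin n) k} (hy : ∀ j, (y j).IsHomogeneous 1)
    (M : ℕ → Submodule k (MvPolynomial (Fin n) k))
    (hIM : ∀ m f, f ∈ I → f.IsHomogeneous m → f ∈ M m)
    (hyM : ∀ m j f, f ∈ M m → y j * f ∈ M (m + 1))
    (h : ∀ m f, f.IsHomogeneous m →
      ∃ t ∈ M m, t.IsHomogeneous m ∧ f - t ∈ I ⊔ Ideal.span (Set.range y)) :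
    ∀ m f, f.IsHomogeneous m → f ∈ M m := by
  intro m
  induction m with
  | zero =>
    intro f hf
    obtain ⟨t, ht, hth, hft⟩ := h 0 f hf
    obtain ⟨a, ha, b, hb, hab⟩ := Submodule.mem_sup.1 hft
    obtain ⟨c, rfl⟩ := (Submodule.mem_span_range_iff_exists_fun _).1 hb
    have h1 : f - t = homogeneousComponent 0 a := by
      rw [← homogeneousComponent_eq_self (hf.sub hth), ← hab, map_add, map_sum]
      rw [Finset.sum_eq_zero, add_zero]
      intro j _
      rw [smul_eq_mul, mul_comm, homogeneousComponent_zero_mul (hy j)]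
    rw [show f = t + (f - t) by ring, h1]
    exact add_mem ht (hIM _ _ (isHomogeneousIdeal_iff.1 hI a ha 0)
      (homogeneousComponent_isHomogeneous _ _))
  | succ m ih =>
    intro f hf
    obtain ⟨t, ht, hth, hft⟩ := h (m + 1) f hf
    obtain ⟨a, ha, b, hb, hab⟩ := Submodule.mem_sup.1 hft
    obtain ⟨c, rfl⟩ := (Submodule.mem_span_range_iff_exists_fun _).1 hb
    have h1 : f - t = homogeneousComponent (m + 1) a +
        ∑ j, y j * homogeneousComponent m (c j) := by
      rw [← homogeneousComponent_eq_self (hf.sub hth), ← hab, map_add, map_sum]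
      congr 1
      refine Finset.sum_congr rfl fun j _ => ?_
      rw [smul_eq_mul, mul_comm, homogeneousComponent_succ_mul (hy j)]
    rw [show f = t + (f - t) by ring, h1]
    refine add_mem ht (add_mem (hIM _ _ (isHomogeneousIdeal_iff.1 hI a ha _)
      (homogeneousComponent_isHomogeneous _ _)) (sum_mem fun j _ => hyM _ _ _ (ih _ ?_)))
    exact homogeneousComponent_isHomogeneous _ _

end Params

/-! ### Krull dimension of integral extensions -/

section KrullDim

/-- Incomparability gives `≤`; lying over together with going up lifts chains of primes and gives
`≥`. -/
lemma ringKrullDim_eq_of_isIntegral_of_injective {R A : Type*} [CommRing R] [CommRing A]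
    [Algebra R A] [Algebra.IsIntegral R A] (hinj : Function.Injective (algebraMap R A)) :
    ringKrullDim A = ringKrullDim R := by
  apply le_antisymm
  · refine Order.krullDim_le_of_strictMono (PrimeSpectrum.comap (algebraMap R A)) ?_
    intro p q hpq
    exact Ideal.IsIntegral.comap_lt_comap (R := R) (I := p.asIdeal) (J := q.asIdeal) hpq
  · have : FaithfulSMul R A := (faithfulSMul_iff_algebraMap_injective R A).2 hinj
    refine iSup_le fun l => ?_
    obtain ⟨p, hp⟩ := Algebra.IsIntegral.comap_surjective R A l.head
    have : p.asIdeal.LiesOver (RelSeries.head l).asIdeal := ⟨by rw [← hp]; rfl⟩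
    obtain ⟨L, hL, -⟩ := Ideal.exists_ltSeries_of_hasGoingUp l p.asIdeal
    rw [← hL]
    exact le_iSup (fun L : LTSeries (PrimeSpectrum A) => (L.length : WithBot ℕ∞)) L

end KrullDim

/-! ### Noether normalization by linear forms -/

section Noether

variable {n : ℕ}

/-- Linear forms `y` such that the quotient of `S / I` by `y` has finite length. -/
structure IsParam (I : Ideal (MvPolynomial (Fin n) k)) {D : ℕ}
    (y : Fin D → MvPolynomial (Fin n) k) : Prop where
  isHomogeneous : ∀ j, (y j).IsHomogeneous 1
  isIrrelevant : IsIrrelevant (I ⊔ Ideal.span (Set.range y))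

lemma homogeneousComponent_aeval {D : ℕ} {y : Fin D → MvPolynomial (Fin n) k}
    (hy : ∀ j, (y j).IsHomogeneous 1) (f : MvPolynomial (Fin D) k) (e : ℕ) :
    homogeneousComponent e (aeval y f) = aeval y (homogeneousComponent e f) := by
  classical
  have key : ∀ i, homogeneousComponent e (aeval y (homogeneousComponent i f)) =
      if e = i then aeval y (homogeneousComponent i f) else 0 := by
    intro i
    have h := (homogeneousComponent_isHomogeneous i f).aeval y hy
    rw [one_mul] at h
    rw [homogeneousComponent_of_mem h]
  conv_lhs => rw [← sum_homogeneousComponent f, map_sum, map_sum]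
  rw [Finset.sum_congr rfl fun i _ => key i, Finset.sum_ite_eq]
  split_ifs with h
  · rfl
  · rw [homogeneousComponent_eq_zero e f (by simpa using h), map_zero]

lemma aeval_mul_of_isHomogeneous {D e : ℕ} {A : Type*} [CommRing A] [Algebra k A]
    {F : MvPolynomial (Fin D) k} (hF : F.IsHomogeneous e) (b : Fin D → k) (z : A) :
    aeval (fun j => algebraMap k A (b j) * z) F = z ^ e * algebraMap k A (eval b F) := by
  rw [aeval_def, eval₂_eq, eval_eq, map_sum, Finset.mul_sum]
  refine Finset.sum_congr rfl fun d hd => ?_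
  have hd' : ∑ i ∈ d.support, d i = e := (hF.degree_eq_sum_deg_support hd).symm
  simp_rw [mul_pow]
  rw [Finset.prod_mul_distrib, Finset.prod_pow_eq_pow_sum, hd', map_mul, map_prod]
  simp only [map_pow]
  ring

/-- A homogeneous relation `F(y) ∈ I` allows one form to be dropped. Over an infinite field there is
a point `c` with `F(c) ≠ 0`, and the forms `y'` obtained by moving `y` along the direction `c` still
have a quotient of finite length, against minimality. -/
theorem IsParam.injective_of_minimal [Infinite k] {I : Ideal (MvPolynomial (Fin n) k)}
    (hI : IsHomogeneousIdeal I) (hne : I ≠ ⊤) {D : ℕ} {y : Fin D → MvPolynomial (Fin n) k}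
    (hy : IsParam I y)
    (hmin : ∀ D' < D, ∀ y' : Fin D' → MvPolynomial (Fin n) k, ¬ IsParam I y') :
    ∀ f : MvPolynomial (Fin D) k, aeval y f ∈ I → f = 0 := by
  intro f hf
  by_contra hf0
  obtain ⟨e, he⟩ : ∃ e, homogeneousComponent e f ≠ 0 := by
    by_contra! h
    apply hf0
    rw [← sum_homogeneousComponent f]
    exact Finset.sum_eq_zero fun i _ => h i
  set F := homogeneousComponent e f
  have hF : F.IsHomogeneous e := homogeneousComponent_isHomogeneous e f
  have hFI : aeval y F ∈ I := by
    rw [← homogeneousComponent_aeval hy.isHomogeneous]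
    exact isHomogeneousIdeal_iff.1 hI _ hf e
  obtain ⟨c, hc⟩ : ∃ c, eval c F ≠ 0 := by
    by_contra! h
    exact he (MvPolynomial.funext fun x => by rw [h x, map_zero])
  have hj : ∃ j₀, c j₀ ≠ 0 := by
    by_contra! h
    have hc0 : c = 0 := funext h
    rcases Nat.eq_zero_or_pos e with rfl | hpos
    · obtain ⟨a, ha⟩ : ∃ a, F = C a :=
        ⟨_, totalDegree_eq_zero_iff_eq_C.1 (Nat.le_zero.1 hF.totalDegree_le)⟩
      rw [ha] at hFI hc
      rw [eval_C] at hc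
      rw [algHom_C] at hFI
      exact hne (Ideal.eq_top_of_isUnit_mem _ hFI ((IsUnit.mk0 _ hc).map _))
    · apply hc
      rw [hc0, eval_zero, constantCoeff_eq]
      exact hF.coeff_eq_zero (by simpa using hpos.ne)
  obtain ⟨j₀, hj₀⟩ := hj
  rcases D with _ | D
  · exact j₀.elim0
  -- These combinations of the `y_j` vanish at `y = c`, so modulo them `y` is `c` times the single
  -- element `z`.
  set y' : Fin D → MvPolynomial (Fin n) k := fun j =>
    y (j₀.succAbove j) - C (c (j₀.succAbove j) * (c j₀)⁻¹) * y j₀ with hy'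
  refine hmin D (Nat.lt_succ_self D) y' ⟨fun j => ?_, ?_⟩
  · exact (hy.isHomogeneous _).sub ((hy.isHomogeneous _).C_mul _)
  set J := I ⊔ Ideal.span (Set.range y') with hJ
  set z : MvPolynomial (Fin n) k ⧸ J := Ideal.Quotient.mk J (C (c j₀)⁻¹ * y j₀) with hz
  have hyz : ∀ j, Ideal.Quotient.mk J (y j) =
      algebraMap k (MvPolynomial (Fin n) k ⧸ J) (c j) * z := by
    intro j
    change _ = Ideal.Quotient.mk J (C (c j)) * z
    rw [hz, ← map_mul, ← mul_assoc, ← C_mul]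
    refine j₀.succAboveCases ?_ (fun i => ?_) j
    · rw [mul_inv_cancel₀ hj₀, C_1, one_mul]
    · rw [Ideal.Quotient.eq]
      exact Ideal.mem_sup_right (Ideal.subset_span ⟨i, rfl⟩)
  -- By homogeneity `F(y) = F(c z) = z ^ e F(c)`. The left side vanishes modulo `J` and `F(c)` is a
  -- unit, so `z` is nilpotent.
  have hzero : z ^ e * algebraMap k (MvPolynomial (Fin n) k ⧸ J) (eval c F) = 0 := by
    rw [← aeval_mul_of_isHomogeneous hF c z]
    simp_rw [← hyz]
    have : Ideal.Quotient.mkₐ k J (aeval y F) = 0 :=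
      Ideal.Quotient.eq_zero_iff_mem.2 (Ideal.mem_sup_left hFI)
    rw [← this, comp_aeval_apply]
    rfl
  have hz0 : z ^ e = 0 := by
    have hu : IsUnit (algebraMap k (MvPolynomial (Fin n) k ⧸ J) (eval c F)) :=
      (IsUnit.mk0 _ hc).map _
    exact hu.mul_left_eq_zero.1 hzero
  have hzrad : C (c j₀)⁻¹ * y j₀ ∈ J.radical :=
    ⟨e, by rw [← Ideal.Quotient.eq_zero_iff_mem, map_pow]; exact hz0⟩
  have hyrad : ∀ j, y j ∈ J.radical := by
    intro j
    have h1 : y j - C (c j) * (C (c j₀)⁻¹ * y j₀) ∈ J := by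
      rw [← Ideal.Quotient.eq, hyz j, map_mul]
      rfl
    have h2 := add_mem (Ideal.le_radical h1) (Ideal.mul_mem_left _ (C (c j)) hzrad)
    rwa [sub_add_cancel] at h2
  have hle : I ⊔ Ideal.span (Set.range y) ≤ J.radical := by
    refine sup_le (le_sup_left.trans Ideal.le_radical) (Ideal.span_le.2 ?_)
    rintro _ ⟨j, rfl⟩
    exact hyrad j
  intro j
  have := Ideal.radical_mono hle (hy.isIrrelevant j)
  rwa [Ideal.radical_idem] at this

/-- Graded Nakayama: all forms of degree at least some `N` lie in `I + (y)`, so the monomials of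
degree at most `N` generate `S/I` over the polynomial ring in the `y_j`. -/
theorem IsParam.finite {I : Ideal (MvPolynomial (Fin n) k)} (hI : IsHomogeneousIdeal I) {D : ℕ}
    {y : Fin D → MvPolynomial (Fin n) k} (hy : IsParam I y) :
    ((Ideal.Quotient.mkₐ k I).comp (aeval y)).toRingHom.Finite := by
  set φ := (Ideal.Quotient.mkₐ k I).comp (aeval y) with hφ
  let _ : Algebra (MvPolynomial (Fin D) k) (MvPolynomial (Fin n) k ⧸ I) := φ.toRingHom.toAlgebra
  let _ : Module (MvPolynomial (Fin D) k) (MvPolynomial (Fin n) k ⧸ I) := Algebra.toModule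
  obtain ⟨N, hN⟩ := hy.isIrrelevant.exists_forall_mem
  have hsmul : ∀ (p : MvPolynomial (Fin D) k) (f : MvPolynomial (Fin n) k),
      p • Ideal.Quotient.mk I f = Ideal.Quotient.mk I (aeval y p * f) := by
    intro p f
    rw [Algebra.smul_def, map_mul]
    rfl
  set T : Set (MvPolynomial (Fin n) k ⧸ I) :=
    (fun α : Fin n →₀ ℕ => Ideal.Quotient.mk I (monomial α 1)) '' {α | α.degree ≤ N} with hT
  have hTfin : T.Finite := (Finsupp.finite_of_degree_le N).image _
  let M : Submodule k (MvPolynomial (Fin n) k) :=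
    { carrier := {f | Ideal.Quotient.mk I f ∈ Submodule.span (MvPolynomial (Fin D) k) T}
      add_mem' := fun {a b} ha hb => by
        simp only [Set.mem_ofPred_eq, map_add] at *; exact add_mem ha hb
      zero_mem' := by simp
      smul_mem' := fun c f hf => by
        simp only [Set.mem_ofPred_eq] at *
        have := Submodule.smul_mem _ (C c : MvPolynomial (Fin D) k) hf
        rw [hsmul, algHom_C] at this
        rwa [smul_eq_C_mul] }
  have key := graded_nakayama hI hy.isHomogeneous (fun _ => M) ?_ ?_ ?_
  · refine ⟨⟨hTfin.toFinset, ?_⟩⟩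
    rw [Set.Finite.coe_toFinset, eq_top_iff]
    rintro x -
    obtain ⟨f, rfl⟩ := Ideal.Quotient.mk_surjective x
    have : f ∈ M := by
      rw [← sum_homogeneousComponent f]
      exact sum_mem fun i _ => key i _ (homogeneousComponent_isHomogeneous i f)
    exact this
  · intro m f hf _
    change Ideal.Quotient.mk I f ∈ Submodule.span (MvPolynomial (Fin D) k) T
    rw [Ideal.Quotient.eq_zero_iff_mem.2 hf]
    exact zero_mem _
  · intro m j f hf
    have := Submodule.smul_mem _ (X j : MvPolynomial (Fin D) k)
      (show Ideal.Quotient.mk I f ∈ Submodule.span (MvPolynomial (Fin D) k) T from hf)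
    rwa [hsmul, aeval_X] at this
  · intro m f hf
    rcases lt_or_ge m N with hm | hm
    · refine ⟨f, ?_, hf, by simp⟩
      rw [f.as_sum]
      refine sum_mem fun α hα => ?_
      rw [← mul_one (coeff α f), ← smul_eq_mul, ← smul_monomial]
      refine Submodule.smul_mem _ _ (Submodule.subset_span ⟨α, ?_, rfl⟩)
      have : α.degree = m := by
        by_contra h
        exact (mem_support_iff.1 hα) (hf.coeff_eq_zero h)
      simp only [Set.mem_ofPred_eq]
      omega
    · exact ⟨0, zero_mem _, isHomogeneous_zero _ _ _, by simpa using hN m hm f hf⟩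

theorem IsParam.ringKrullDim_eq {I : Ideal (MvPolynomial (Fin n) k)} (hI : IsHomogeneousIdeal I)
    {D : ℕ} {y : Fin D → MvPolynomial (Fin n) k} (hy : IsParam I y)
    (hinj : ∀ f : MvPolynomial (Fin D) k, aeval y f ∈ I → f = 0) :
    ringKrullDim (MvPolynomial (Fin n) k ⧸ I) = D := by
  have hfin := hy.finite hI
  set φ := (Ideal.Quotient.mkₐ k I).comp (aeval y) with hφ
  let _ : Algebra (MvPolynomial (Fin D) k) (MvPolynomial (Fin n) k ⧸ I) := φ.toRingHom.toAlgebra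
  let _ : Module (MvPolynomial (Fin D) k) (MvPolynomial (Fin n) k ⧸ I) := Algebra.toModule
  have : Module.Finite (MvPolynomial (Fin D) k) (MvPolynomial (Fin n) k ⧸ I) := hfin
  have : Algebra.IsIntegral (MvPolynomial (Fin D) k) (MvPolynomial (Fin n) k ⧸ I) :=
    Algebra.IsIntegral.of_finite _ _
  rw [ringKrullDim_eq_of_isIntegral_of_injective (R := MvPolynomial (Fin D) k)]
  · simp
  · refine (injective_iff_map_eq_zero φ.toRingHom).2 fun f hf => hinj f ?_
    exact Ideal.Quotient.eq_zero_iff_mem.1 hf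

lemma isParam_X (I : Ideal (MvPolynomial (Fin n) k)) :
    IsParam I (fun j : Fin n => (X j : MvPolynomial (Fin n) k)) :=
  ⟨fun j => isHomogeneous_X k j, fun j =>
    Ideal.le_radical (Ideal.mem_sup_right (Ideal.subset_span ⟨j, rfl⟩))⟩

/-- Noether normalization by linear forms, with the minimality of the number of forms. -/
theorem exists_isParam [Infinite k] {I : Ideal (MvPolynomial (Fin n) k)}
    (hI : IsHomogeneousIdeal I) (hne : I ≠ ⊤) :
    ∃ D : ℕ, ringKrullDim (MvPolynomial (Fin n) k ⧸ I) = D ∧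
      (∃ y : Fin D → MvPolynomial (Fin n) k, IsParam I y ∧
        ∀ f : MvPolynomial (Fin D) k, aeval y f ∈ I → f = 0) ∧
      ∀ D' < D, ∀ y' : Fin D' → MvPolynomial (Fin n) k, ¬ IsParam I y' := by
  classical
  have hex : ∃ D, ∃ y : Fin D → MvPolynomial (Fin n) k, IsParam I y := ⟨n, _, isParam_X I⟩
  obtain ⟨y, hy⟩ := Nat.find_spec hex
  have hmin : ∀ D' < Nat.find hex, ∀ y' : Fin D' → MvPolynomial (Fin n) k, ¬ IsParam I y' :=
    fun D' hD' y' hy' => Nat.find_min hex hD' ⟨y', hy'⟩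
  have hinj := hy.injective_of_minimal hI hne hmin
  exact ⟨_, hy.ringKrullDim_eq hI hinj, ⟨y, hy, hinj⟩, hmin⟩

lemma finrank_homogeneousSubmodule (s m : ℕ) :
    Module.finrank k (homogeneousSubmodule (Fin s) k m) = Nat.multichoose s m := by
  classical
  have e : homogeneousSubmodule (Fin s) k m = restrictSupport k {d : Fin s →₀ ℕ | d.degree = m} :=
    homogeneousSubmodule_eq_finsupp_supported _ _ _
  rw [e, Module.finrank_eq_nat_card_basis (basisRestrictSupport k _)]
  have h := Finset.card_finsuppAntidiag_nat_eq_multichoose (s := (Finset.univ : Finset (Fin s))) m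
  rw [Finset.card_univ, Fintype.card_fin] at h
  rw [← h, ← Set.ncard_coe_finset, ← Nat.card_coe_set_eq]
  congr 2
  ext d
  simp [Finset.mem_finsuppAntidiag, Finsupp.degree_eq_sum]

/-- A polynomial subring in `D` linear forms bounds the order of the pole at `1` below. -/
theorem le_of_hilbertSeries_mul {I : Ideal (MvPolynomial (Fin n) k)} {D D' : ℕ}
    {y : Fin D → MvPolynomial (Fin n) k} (hy : ∀ j, (y j).IsHomogeneous 1)
    (hinj : ∀ f : MvPolynomial (Fin D) k, aeval y f ∈ I → f = 0) {q : Polynomial ℤ}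
    (hq : (q : PowerSeries ℤ) = hilbertSeries I * (1 - PowerSeries.X) ^ D') : D ≤ D' := by
  by_contra! hlt
  have hle : ∀ m, Nat.multichoose D m ≤ hilbertFunction I m := by
    intro m
    rw [← finrank_homogeneousSubmodule (k := k)]
    set φ := ((Ideal.Quotient.mkₐ k I).comp (aeval y)).toLinearMap with hφ
    have hφinj : Function.Injective φ :=
      (injective_iff_map_eq_zero φ).2 fun f hf => hinj f (Ideal.Quotient.eq_zero_iff_mem.1 hf)
    rw [LinearEquiv.finrank_eq (Submodule.equivMapOfInjective φ hφinj _)]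
    refine Submodule.finrank_mono ?_
    rintro _ ⟨f, hf, rfl⟩
    refine ⟨aeval y f, ?_, rfl⟩
    have := IsHomogeneous.aeval (show f.IsHomogeneous m from hf) y hy
    rwa [one_mul] at this
  -- The polynomial ring in `D` variables has series `1/(1 - t)^D`. If `D > D'`, the numerator of
  -- the difference takes the value `-1` at `1`, although its coefficients are nonnegative.
  have h := eval_one_nonneg_of_coeff_nonneg (q * (1 - Polynomial.X) ^ (D - D') - 1) D
    (hilbertSeries I - PowerSeries.mk fun m => (Nat.multichoose D m : ℤ)) ?_ ?_
  · have h0 : D - D' ≠ 0 := by omega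
    simp [h0] at h
  · rw [sub_mul, mk_multichoose_mul]
    push_cast
    rw [hq, mul_assoc, ← pow_add, show D' + (D - D') = D by omega]
  · intro m
    simp only [hilbertSeries, map_sub, PowerSeries.coeff_mk, sub_nonneg]
    exact_mod_cast hle m

end Noether

/-! ### Generic freeness -/

section GenericComplement

variable {R : Type*} [CommRing R] {n : ℕ}

/-- Generic freeness of `R[x] / J` over a domain `R`: after inverting one nonzero element, the
span of the monomials that are not leading monomials of `J` is a complement of `J`. -/
theorem exists_generic_complement [IsDomain R] (J : Ideal (MvPolynomial (Fin n) R)) :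
    ∃ F : R, F ≠ 0 ∧ ∃ W : Submodule R (MvPolynomial (Fin n) R),
      (∀ f ∈ J, f ∈ W → f = 0) ∧ ∀ g, ∃ N : ℕ, ∃ j ∈ J, ∃ w ∈ W, C F ^ N * g = j + w := by
  classical
  let m : MonomialOrder (Fin n) := MonomialOrder.lex
  set E : Set (Fin n →₀ ℕ) := {d | ∃ f ∈ J, f ≠ 0 ∧ m.degree f = d} with hE
  have hfin : {d | Minimal (· ∈ E) d}.Finite :=
    -- Dickson's lemma. Finitely many leading coefficients therefore suffice, and `F` is their
    -- product; `W` is spanned by the monomials divisible by no minimal leading monomial.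
    WellQuasiOrderedLE.finite_of_isAntichain (setOfPred_minimal_antichain _)
  have hrep : ∀ d, Minimal (· ∈ E) d → ∃ f ∈ J, f ≠ 0 ∧ m.degree f = d := fun d hd => hd.1
  choose! r hrJ hr0 hrd using hrep
  set T := hfin.toFinset with hT
  have hTmem : ∀ d, d ∈ T ↔ Minimal (· ∈ E) d := fun d => by simp [hT]
  set F : R := ∏ d ∈ T, m.leadingCoeff (r d) with hF
  have hlc : ∀ d ∈ T, m.leadingCoeff (r d) ≠ 0 := fun d hd =>
    m.leadingCoeff_ne_zero_iff.2 (hr0 d ((hTmem d).1 hd))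
  set W : Submodule R (MvPolynomial (Fin n) R) := restrictSupport R {d | ∀ t ∈ T, ¬ t ≤ d} with hW
  have hCW : ∀ (c : R) (w : MvPolynomial (Fin n) R), w ∈ W → C c * w ∈ W := fun c w hw => by
    rw [← smul_eq_C_mul]; exact W.smul_mem c hw
  refine ⟨F, Finset.prod_ne_zero_iff.2 hlc, W, ?_, ?_⟩
  · intro f hfJ hfW
    by_contra hf0
    obtain ⟨t, htle, ht⟩ := exists_minimal_le_of_wellFoundedLT (· ∈ E) (m.degree f)
      ⟨f, hfJ, hf0, rfl⟩
    have := (mem_restrictSupport_iff R).1 hfW (m.degree_mem_support hf0)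
    exact this t ((hTmem t).2 ht) htle
  -- Division algorithm by induction on the leading monomial: a standard leading term goes to `W`;
  -- any other is cancelled by a multiple of some `r t`, after multiplication by the leading
  -- coefficient of `r t`, a factor of `F`.
  · have main : ∀ a : m.syn, ∀ g : MvPolynomial (Fin n) R, m.toSyn (m.degree g) = a →
        ∃ N : ℕ, ∃ j ∈ J, ∃ w ∈ W, C F ^ N * g = j + w := by
      intro a
      induction a using WellFoundedLT.induction with
      | ind a ih' =>
      intro g hg
      have ih : ∀ h : MvPolynomial (Fin n) R,
          (∀ d ∈ h.support, m.toSyn d < m.toSyn (m.degree g)) →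
          ∃ N : ℕ, ∃ j ∈ J, ∃ w ∈ W, C F ^ N * h = j + w := by
        intro h hh
        by_cases hh0 : h = 0
        · exact ⟨0, 0, zero_mem _, 0, zero_mem _, by simp [hh0]⟩
        · exact ih' _ (hg ▸ hh _ (m.degree_mem_support hh0)) h rfl
      have hsupp : ∀ h : MvPolynomial (Fin n) R, m.toSyn (m.degree h) ≤ m.toSyn (m.degree g) →
          coeff (m.degree g) h = 0 → ∀ d ∈ h.support, m.toSyn d < m.toSyn (m.degree g) := by
        intro h hle hc d hd
        refine lt_of_le_of_ne ((m.le_degree hd).trans hle) fun heq => ?_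
        rw [m.toSyn.injective heq] at hd
        exact mem_support_iff.1 hd hc
      by_cases hstd : ∀ t ∈ T, ¬ t ≤ m.degree g
      · obtain ⟨N, j, hj, w, hw, hjw⟩ := ih (g - m.leadingTerm g)
          (hsupp _ (m.degree_sub_leadingTerm_le g)
            (by simp [MonomialOrder.leadingTerm, MonomialOrder.leadingCoeff]))
        refine ⟨N, j, hj, w + C F ^ N * m.leadingTerm g, add_mem hw ?_, ?_⟩
        · rw [← C_pow]
          refine hCW _ _ ?_
          rw [MonomialOrder.leadingTerm]
          exact (monomial_mem_restrictSupport R).2 (Or.inl hstd)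
        · rw [← add_assoc, ← hjw]; ring
      · push Not at hstd
        obtain ⟨t, htT, hle⟩ := hstd
        have ht := (hTmem t).1 htT
        set F' := ∏ d ∈ T.erase t, m.leadingCoeff (r d)
        have hFF' : F = m.leadingCoeff (r t) * F' := (Finset.mul_prod_erase T _ htT).symm
        obtain ⟨e, he⟩ := exists_add_of_le hle
        set c := m.leadingCoeff g
        have hdeg : m.toSyn (m.degree (C (m.leadingCoeff (r t)) * g - monomial e c * r t)) ≤
            m.toSyn (m.degree g) := by
          refine m.degree_sub_le.trans (sup_le ?_ ?_)
          · refine m.degree_mul_le.trans ?_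
            simp
          · refine m.degree_mul_le.trans ?_
            rw [hrd t ht, he, map_add, map_add, add_comm]
            gcongr
            exact m.degree_monomial_le c
        have hcoeff : coeff (m.degree g)
            (C (m.leadingCoeff (r t)) * g - monomial e c * r t) = 0 := by
          rw [coeff_sub, coeff_C_mul, he, add_comm t e, coeff_monomial_mul, add_comm e t, ← he]
          have : coeff t (r t) = m.leadingCoeff (r t) := by
            rw [MonomialOrder.leadingCoeff, hrd t ht]
          rw [this, mul_comm]
          exact sub_self _
        obtain ⟨N, j, hj, w, hw, hjw⟩ := ih _ (hsupp _ hdeg hcoeff)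
        refine ⟨N + 1, C F' * j + C F ^ N * C F' * (monomial e c * r t), ?_, C F' * w,
          hCW _ _ hw, ?_⟩
        · exact add_mem (J.mul_mem_left _ hj)
            (J.mul_mem_left _ (J.mul_mem_left _ (hrJ t ht)))
        · have : C F ^ (N + 1) * g = C F ^ N * C F' * (C (m.leadingCoeff (r t)) * g) := by
            rw [pow_succ]
            nth_rewrite 2 [hFF']
            rw [C_mul]
            ring
          rw [this]
          linear_combination C F' * hjw
    exact fun g => main _ g rfl

/-- If `y ∈ J` vanishes modulo `𝔫 = ker ev`, then `y ∈ 𝔫 J` up to powers of `F`. -/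
lemma pow_mul_mem_smul_of_complement {J : Ideal (MvPolynomial (Fin n) R)} {F : R}
    {W : Submodule R (MvPolynomial (Fin n) R)} (h0 : ∀ f ∈ J, f ∈ W → f = 0)
    (hJW : ∀ g, ∃ N : ℕ, ∃ j ∈ J, ∃ w ∈ W, C F ^ N * g = j + w)
    {R' : Type*} [CommRing R'] (ev : R →+* R') {y : MvPolynomial (Fin n) R} (hy : y ∈ J)
    (hev : map ev y = 0) :
    ∃ N : ℕ, C F ^ N * y ∈ RingHom.ker ev • (J.restrictScalars R : Submodule R _) := by
  classical
  have hmem : y ∈ RingHom.ker ev • (⊤ : Submodule R (MvPolynomial (Fin n) R)) := by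
    rw [y.as_sum]
    refine sum_mem fun d _ => ?_
    rw [← mul_one (coeff d y), ← smul_eq_mul, ← smul_monomial]
    refine Submodule.smul_mem_smul ?_ trivial
    rw [RingHom.mem_ker, ← coeff_map, hev, coeff_zero]
  -- Decomposing the factors in `y = ∑ c g` with `c ∈ ker ev` puts the `J`-part in `ker ev • J`. The
  -- remaining `W`-part lies in `J ∩ W = 0`.
  have key : ∃ N : ℕ, ∃ j ∈ RingHom.ker ev • (J.restrictScalars R : Submodule R _), ∃ w ∈ W,
      C F ^ N * y = j + w := by
    refine Submodule.smul_induction_on hmem ?_ ?_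
    · intro c hc g _
      obtain ⟨N, j, hj, w, hw, hjw⟩ := hJW g
      refine ⟨N, c • j, Submodule.smul_mem_smul hc hj, c • w, W.smul_mem c hw, ?_⟩
      rw [← smul_add, ← hjw, mul_smul_comm]
    · rintro x z ⟨N, j, hj, w, hw, hjw⟩ ⟨N', j', hj', w', hw', hjw'⟩
      refine ⟨N + N', F ^ N' • j + F ^ N • j', add_mem (Submodule.smul_mem _ _ hj)
        (Submodule.smul_mem _ _ hj'), F ^ N' • w + F ^ N • w', add_mem (W.smul_mem _ hw)
        (W.smul_mem _ hw'), ?_⟩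
      simp only [smul_eq_C_mul, C_pow]
      linear_combination C F ^ N' * hjw + C F ^ N * hjw'
  obtain ⟨N, j, hj, w, hw, hjw⟩ := key
  refine ⟨N, ?_⟩
  have hjJ : j ∈ J := (Submodule.smul_le_right (N := J.restrictScalars R)) hj
  have hw0 : w = 0 := h0 w (by
    rw [show w = C F ^ N * y - j by rw [hjw]; ring]
    exact sub_mem (J.mul_mem_left _ hy) hjJ) hw
  rwa [hjw, hw0, add_zero]

end GenericComplement

/-! ### Generic linear forms and filter-regularity -/

section Generic

variable {n s : ℕ}

/-- The ideal generated by `P` and the first `i` of the forms `l`. -/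
def partialIdeal {R : Type*} [CommRing R] (P : Ideal R) (l : Fin s → R) (i : ℕ) : Ideal R :=
  P ⊔ Ideal.span {f | ∃ p : Fin s, p.val < i ∧ l p = f}

lemma partialIdeal_mem {R : Type*} [CommRing R] (P : Ideal R) (l : Fin s → R) {i : ℕ} {p : Fin s}
    (hp : p.val < i) : l p ∈ partialIdeal P l i :=
  Ideal.mem_sup_right (Ideal.subset_span ⟨p, hp, rfl⟩)

lemma partialIdeal_le {R : Type*} [CommRing R] {P J : Ideal R} {l : Fin s → R} {i : ℕ} :
    partialIdeal P l i ≤ J ↔ P ≤ J ∧ ∀ p : Fin s, p.val < i → l p ∈ J := by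
  rw [partialIdeal, sup_le_iff, Ideal.span_le]
  refine and_congr_right fun _ => ⟨fun h p hp => h ⟨p, hp, rfl⟩, ?_⟩
  rintro h _ ⟨p, hp, rfl⟩
  exact h p hp

lemma partialIdeal_zero {R : Type*} [CommRing R] (P : Ideal R) (l : Fin s → R) :
    partialIdeal P l 0 = P :=
  le_antisymm (partialIdeal_le.2 ⟨le_rfl, fun _ h => absurd h (Nat.not_lt_zero _)⟩) le_sup_left

lemma partialIdeal_succ {R : Type*} [CommRing R] (P : Ideal R) (l : Fin s → R) (i : Fin s) :
    partialIdeal P l (i.val + 1) = partialIdeal P l i.val ⊔ Ideal.span {l i} := by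
  apply le_antisymm
  · refine partialIdeal_le.2 ⟨le_sup_left.trans le_sup_left, fun p hp => ?_⟩
    rcases Nat.lt_succ_iff_lt_or_eq.1 hp with h | h
    · exact Ideal.mem_sup_left (partialIdeal_mem P l h)
    · rw [Fin.ext h]
      exact Ideal.mem_sup_right (Ideal.mem_span_singleton_self _)
  · refine sup_le (partialIdeal_le.2 ⟨le_sup_left, fun p hp =>
      partialIdeal_mem P l (Nat.lt_succ_of_lt hp)⟩) ?_
    rw [Ideal.span_singleton_le_iff_mem]
    exact partialIdeal_mem P l (Nat.lt_succ_self _)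

/-- The generic linear forms, with indeterminate coefficients. -/
def genericForm (k : Type*) [Field k] (n : ℕ) {s : ℕ} (i : Fin s) :
    MvPolynomial (Fin n) (MvPolynomial (Fin s × Fin n) k) :=
  ∑ q, C (X (i, q)) * X q

/-- Extension of scalars of an ideal to the ring of coefficients of the generic forms. -/
def genericExtension (s : ℕ) (P : Ideal (MvPolynomial (Fin n) k)) :
    Ideal (MvPolynomial (Fin n) (MvPolynomial (Fin s × Fin n) k)) :=
  P.map (map (C : k →+* MvPolynomial (Fin s × Fin n) k))

section Elimination

variable {K : Type*} [Field K] (γ : MvPolynomial (Fin n) k →+* K)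

/-- The substitution of the classes of the variables in the coefficient field. -/
def substGeneric (U : Fin s × Fin n → MvPolynomial (Fin s × Fin n) K) :
    MvPolynomial (Fin n) (MvPolynomial (Fin s × Fin n) k) →+* MvPolynomial (Fin s × Fin n) K :=
  eval₂Hom (eval₂Hom (C.comp (γ.comp C)) U) (fun q => C (γ (X q)))

lemma substGeneric_X (U : Fin s × Fin n → MvPolynomial (Fin s × Fin n) K) (q : Fin n) :
    substGeneric γ U (X q) = C (γ (X q)) := by simp [substGeneric]

lemma substGeneric_C_X (U : Fin s × Fin n → MvPolynomial (Fin s × Fin n) K) (p : Fin s × Fin n) :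
    substGeneric γ U (C (X p)) = U p := by simp [substGeneric]

lemma substGeneric_C_C (U : Fin s × Fin n → MvPolynomial (Fin s × Fin n) K) (c : k) :
    substGeneric γ U (C (C c)) = C (γ (C c)) := by simp [substGeneric]

lemma substGeneric_map (U : Fin s × Fin n → MvPolynomial (Fin s × Fin n) K)
    (f : MvPolynomial (Fin n) k) : substGeneric γ U (map C f) = C (γ f) := by
  induction f using MvPolynomial.induction_on with
  | C c => rw [map_C, substGeneric_C_C]
  | add f g hf hg => simp only [map_add, hf, hg]
  | mul_X f i hf => simp only [map_mul, hf, map_X, substGeneric_X]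

/-- With the two sets of variables interchanged, this substitution applies `γ` to coefficients, and
membership in an extended ideal is tested coefficientwise. -/
lemma mem_genericExtension_of_substGeneric {f} (hf : substGeneric (s := s) γ X f = 0) :
    f ∈ genericExtension s (RingHom.ker γ) := by
  set e := commAlgEquiv k (Fin n) (Fin s × Fin n)
  have h1 : ∀ f, substGeneric (s := s) γ X f = map γ (e f) := by
    intro f
    have : substGeneric (s := s) γ X = (map γ).comp (e : _ →+* _) := by
      refine MvPolynomial.ringHom_ext' (MvPolynomial.ringHom_ext' ?_ ?_) ?_
      · ext c; simp [e, substGeneric]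
      · intro p; simp [e, substGeneric]
      · intro q; simp [e, substGeneric]
    rw [this]; rfl
  have h2 : e f ∈ (RingHom.ker γ).map (C : _ →+* MvPolynomial (Fin s × Fin n) _) := by
    rw [mem_map_C_iff]
    intro d
    have := congrArg (coeff d) ((h1 f).symm.trans hf)
    rwa [coeff_map, coeff_zero] at this
  have h3 : ∀ p : MvPolynomial (Fin n) k, e (map C p) = C p := by
    intro p
    induction p using MvPolynomial.induction_on with
    | C c => simp [e]
    | add f g hf hg => simp only [map_add, hf, hg]
    | mul_X f i hf => simp only [map_mul, hf, map_X, e, commAlgEquiv_X]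
  have h4 := Ideal.mem_map_of_mem e.symm.toRingEquiv.toRingHom h2
  rw [Ideal.map_map] at h4
  have h5 : e.symm.toRingEquiv.toRingHom.comp C =
      map (σ := Fin n) (C : k →+* MvPolynomial (Fin s × Fin n) k) := by
    refine RingHom.ext fun p => ?_
    change e.symm (C p) = _
    rw [← h3, AlgEquiv.symm_apply_apply]
  rw [h5] at h4
  have h6 : e.symm.toRingEquiv.toRingHom (e f) = f := e.symm_apply_apply f
  rwa [h6] at h4

/-- The solution of the first `i` generic forms for the coefficients of the variable `j`. -/
def eliminate (i : ℕ) (j : Fin n) (p : Fin s × Fin n) : MvPolynomial (Fin s × Fin n) K :=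
  if p.2 = j ∧ p.1.val < i then
    - ∑ q ∈ Finset.univ.erase j, X (p.1, q) * C (γ (X q) * (γ (X j))⁻¹)
  else X p

lemma substGeneric_eliminate_of_mem {i : ℕ} {j : Fin n} (hj : γ (X j) ≠ 0) {f}
    (hf : f ∈ partialIdeal (genericExtension s (RingHom.ker γ)) (genericForm k n) i) :
    substGeneric γ (eliminate γ i j) f = 0 := by
  suffices h : partialIdeal (genericExtension s (RingHom.ker γ)) (genericForm k n) i ≤
      RingHom.ker (substGeneric γ (eliminate γ i j)) from h hf
  refine partialIdeal_le.2 ⟨Ideal.map_le_iff_le_comap.2 fun g hg => ?_, fun p hp => ?_⟩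
  · rw [Ideal.mem_comap, RingHom.mem_ker, substGeneric_map, hg, map_zero]
  · rw [RingHom.mem_ker, genericForm, map_sum, ← Finset.add_sum_erase _ _ (Finset.mem_univ j)]
    simp only [map_mul, substGeneric_X, substGeneric_C_X]
    have h1 : ∀ q ∈ Finset.univ.erase j,
        eliminate γ i j (p, q) * C (γ (X q)) = X (p, q) * C (γ (X q)) := by
      intro q hq
      rw [eliminate, if_neg (fun h => (Finset.ne_of_mem_erase hq) h.1)]
    rw [Finset.sum_congr rfl h1, eliminate, if_pos ⟨rfl, hp⟩, neg_mul, Finset.sum_mul,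
      neg_add_eq_zero]
    refine Finset.sum_congr rfl fun q _ => ?_
    rw [mul_assoc, ← C_mul, mul_assoc, inv_mul_cancel₀ hj, mul_one]

/-- Modulo the `p`-th generic form, `X j` times the coefficient of `X j` is a combination of the
other coefficients, so a power of `X j` clears all eliminated indeterminates. The equality of the
two substitutions on `g` expresses that `g` does not see them; the set of such `f` is closed under
sums and products. -/
lemma exists_elimination (i : ℕ) (j : Fin n)
    (f : MvPolynomial (Fin n) (MvPolynomial (Fin s × Fin n) k)) :
    ∃ N : ℕ, ∃ g, X j ^ N * f - g ∈
      partialIdeal (genericExtension s (RingHom.ker γ)) (genericForm k n) i ∧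
      substGeneric γ (eliminate γ i j) g = substGeneric γ X g := by
  set J := partialIdeal (genericExtension s (RingHom.ker γ)) (genericForm k n) i
  set θ := substGeneric (s := s) γ (eliminate γ i j)
  set θ₀ := substGeneric (s := s) γ X
  have hadd : ∀ f f' : MvPolynomial (Fin n) (MvPolynomial (Fin s × Fin n) k),
      (∃ N : ℕ, ∃ g, X j ^ N * f - g ∈ J ∧ θ g = θ₀ g) →
      (∃ N : ℕ, ∃ g, X j ^ N * f' - g ∈ J ∧ θ g = θ₀ g) →
      ∃ N : ℕ, ∃ g, X j ^ N * (f + f') - g ∈ J ∧ θ g = θ₀ g := by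
    rintro f f' ⟨N, g, hg, hθ⟩ ⟨N', g', hg', hθ'⟩
    refine ⟨N + N', X j ^ N' * g + X j ^ N * g', ?_, ?_⟩
    · have := add_mem (J.mul_mem_left (X j ^ N') hg) (J.mul_mem_left (X j ^ N) hg')
      convert this using 1
      ring
    · simp only [map_add, map_mul, map_pow, hθ, hθ', θ, θ₀, substGeneric_X]
  have hmul : ∀ f f' : MvPolynomial (Fin n) (MvPolynomial (Fin s × Fin n) k),
      (∃ N : ℕ, ∃ g, X j ^ N * f - g ∈ J ∧ θ g = θ₀ g) →
      (∃ N : ℕ, ∃ g, X j ^ N * f' - g ∈ J ∧ θ g = θ₀ g) →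
      ∃ N : ℕ, ∃ g, X j ^ N * (f * f') - g ∈ J ∧ θ g = θ₀ g := by
    rintro f f' ⟨N, g, hg, hθ⟩ ⟨N', g', hg', hθ'⟩
    refine ⟨N + N', g * g', ?_, ?_⟩
    · have := add_mem (J.mul_mem_left (X j ^ N' * f') hg) (J.mul_mem_left g hg')
      convert this using 1
      ring
    · simp only [map_mul, hθ, hθ']
  have htriv : ∀ f, θ f = θ₀ f → ∃ N : ℕ, ∃ g, X j ^ N * f - g ∈ J ∧ θ g = θ₀ g :=
    fun f hf => ⟨0, f, by simp, hf⟩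
  induction f using MvPolynomial.induction_on with
  | add f f' hf hf' => exact hadd _ _ hf hf'
  | mul_X f q hf => exact hmul _ _ hf (htriv _ (by simp only [θ, θ₀, substGeneric_X]))
  | C c =>
    induction c using MvPolynomial.induction_on with
    | C c => exact htriv _ (by simp only [θ, θ₀, substGeneric_C_C])
    | add f f' hf hf' => rw [C_add]; exact hadd _ _ hf hf'
    | mul_X f p hf =>
      rw [C_mul]
      refine hmul _ _ hf ?_
      by_cases hp : p.2 = j ∧ p.1.val < i
      · refine ⟨1, - ∑ q ∈ Finset.univ.erase j, C (X (p.1, q)) * X q, ?_, ?_⟩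
        · have hmem : genericForm k n p.1 ∈ J := partialIdeal_mem _ _ hp.2
          rw [genericForm, ← Finset.add_sum_erase _ _ (Finset.mem_univ j)] at hmem
          convert hmem using 1
          rw [← hp.1]
          ring
        · simp only [map_neg, map_sum, map_mul, θ, θ₀, substGeneric_X, substGeneric_C_X]
          congr 1
          refine Finset.sum_congr rfl fun q hq => ?_
          rw [eliminate, if_neg (fun h => (Finset.ne_of_mem_erase hq) h.1)]
      · exact htriv _ (by simp only [θ, θ₀, substGeneric_C_X, eliminate, if_neg hp])

end Elimination

/-- The next generic form is a nonzerodivisor modulo the previous ones, up to torsion with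
respect to the variables. -/
lemma generic_filter_regular {P : Ideal (MvPolynomial (Fin n) k)} (hP : P.IsPrime) (i : Fin s)
    (j : Fin n) (f : MvPolynomial (Fin n) (MvPolynomial (Fin s × Fin n) k))
    (hf : genericForm k n i * f ∈ partialIdeal (genericExtension s P) (genericForm k n) i.val) :
    ∃ N : ℕ, X j ^ N * f ∈ partialIdeal (genericExtension s P) (genericForm k n) i.val := by
  classical
  by_cases hXj : X j ∈ P
  · refine ⟨1, Ideal.mem_sup_left ?_⟩
    rw [pow_one]
    refine Ideal.mul_mem_right _ _ ?_
    have := Ideal.mem_map_of_mem (map (C : k →+* MvPolynomial (Fin s × Fin n) k)) hXj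
    rwa [map_X] at this
  let γ : MvPolynomial (Fin n) k →+* FractionRing (MvPolynomial (Fin n) k ⧸ P) :=
    (algebraMap (MvPolynomial (Fin n) k ⧸ P) _).comp (Ideal.Quotient.mk P)
  have hγ : RingHom.ker γ = P := by
    ext f
    rw [RingHom.mem_ker, RingHom.comp_apply,
      map_eq_zero_iff _ (IsFractionRing.injective (MvPolynomial (Fin n) k ⧸ P) _),
      Ideal.Quotient.eq_zero_iff_mem]
  have hj : γ (X j) ≠ 0 := by rwa [Ne, ← RingHom.mem_ker, hγ]
  obtain ⟨N, g, hg, hθ⟩ := exists_elimination γ i.val j f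
  have h1 : substGeneric γ (eliminate γ i.val j) (genericForm k n i * f) = 0 :=
    substGeneric_eliminate_of_mem γ hj (by rwa [hγ])
  -- Only the forms before `i` are eliminated, so the indeterminate `(i, j)` survives with
  -- coefficient `γ (X j) ≠ 0`.
  have h2 : substGeneric γ (eliminate γ i.val j) (genericForm k n i) ≠ 0 := by
    intro h0
    have h3 := congrArg (coeff (Finsupp.single (i, j) 1)) h0
    have h4 : substGeneric γ (eliminate γ i.val j) (genericForm k n i) =
        ∑ q, C (γ (X q)) * X (i, q) := by
      rw [genericForm, map_sum]
      refine Finset.sum_congr rfl fun q _ => ?_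
      rw [map_mul, substGeneric_X, substGeneric_C_X, eliminate,
        if_neg (fun h => lt_irrefl _ h.2), mul_comm]
    rw [h4, coeff_sum, coeff_zero] at h3
    simp only [coeff_C_mul, coeff_X, Finsupp.single_left_inj (one_ne_zero), Prod.mk.injEq,
      true_and, mul_ite, mul_one, mul_zero, Finset.sum_ite_eq',
      Finset.mem_univ, if_true] at h3
    exact hj h3
  rw [map_mul] at h1
  -- The target is a domain, so the image of `f`, and with it that of `g`, vanishes. Since `g`
  -- avoids the eliminated indeterminates, it lies in the extension of `P`.
  have h3 := (mul_eq_zero.1 h1).resolve_left h2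
  have h4 := substGeneric_eliminate_of_mem γ hj hg
  rw [map_sub, map_mul, h3, mul_zero, zero_sub, neg_eq_zero, hθ] at h4
  have h5 := mem_genericExtension_of_substGeneric γ h4
  rw [hγ] at h5 hg
  refine ⟨N, ?_⟩
  have := add_mem hg (Ideal.mem_sup_left h5 : g ∈ partialIdeal (genericExtension s P) _ i.val)
  rwa [sub_add_cancel] at this

/-- `l` is a filter-regular sequence on `S / P`. -/
def IsFilterRegular (P : Ideal (MvPolynomial (Fin n) k)) (l : Fin s → MvPolynomial (Fin n) k) :
    Prop :=
  ∀ i : Fin s, ∀ f, l i * f ∈ partialIdeal P l i.val →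
    ∀ j, ∃ N : ℕ, X j ^ N * f ∈ partialIdeal P l i.val

/-- General linear forms are filter-regular. -/
theorem exists_forall_isFilterRegular {P : Ideal (MvPolynomial (Fin n) k)} (hP : P.IsPrime)
    (s : ℕ) : ∃ F : MvPolynomial (Fin s × Fin n) k, F ≠ 0 ∧ ∀ a : Fin s → Fin n → k,
      eval (fun p => a p.1 p.2) F ≠ 0 → IsFilterRegular P (fun i => linearForm (a i)) := by
  choose F hF0 W hW hJW using fun i : Fin s =>
    exists_generic_complement (partialIdeal (genericExtension s P) (genericForm k n) (i.val + 1))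
  refine ⟨∏ i, F i, Finset.prod_ne_zero_iff.2 fun i _ => hF0 i, fun a ha i f hf j => ?_⟩
  set ev : MvPolynomial (Fin s × Fin n) k →+* k := eval (fun p => a p.1 p.2) with hev
  have hFi : ev (F i) ≠ 0 := by
    rw [map_prod] at ha
    exact Finset.prod_ne_zero_iff.1 ha i (Finset.mem_univ i)
  set l : Fin s → MvPolynomial (Fin n) k := fun i => linearForm (a i) with hl
  set G := genericExtension s P
  set L : Fin s → MvPolynomial (Fin n) (MvPolynomial (Fin s × Fin n) k) := genericForm k n
  have hevL : ∀ p, map ev (L p) = l p := by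
    intro p
    simp [L, genericForm, hl, linearForm, hev]
  have hevC : ∀ g : MvPolynomial (Fin n) k, map ev (map C g) = g := by
    intro g
    rw [map_map]
    convert map_id g
    ext c
    simp [hev]
  have hmap : ∀ i : ℕ, ∀ g ∈ partialIdeal G L i, map ev g ∈ partialIdeal P l i := by
    intro i
    suffices h : partialIdeal G L i ≤ (partialIdeal P l i).comap (map ev) from fun g hg => h hg
    refine partialIdeal_le.2 ⟨Ideal.map_le_iff_le_comap.2 fun g hg => ?_, fun p hp => ?_⟩
    · rw [Ideal.mem_comap, Ideal.mem_comap, hevC]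
      exact Ideal.mem_sup_left hg
    · rw [Ideal.mem_comap, hevL]
      exact partialIdeal_mem P l hp
  have hlift : ∀ g ∈ partialIdeal P l i.val, ∃ y ∈ partialIdeal G L i.val, map ev y = g := by
    have hsurj : Function.Surjective (map (σ := Fin n) ev) := fun g => ⟨_, hevC g⟩
    suffices h : partialIdeal P l i.val ≤ (partialIdeal G L i.val).map (map ev) from
      fun g hg => (Ideal.mem_map_iff_of_surjective _ hsurj).1 (h hg)
    refine partialIdeal_le.2 ⟨fun g hg => ?_, fun p hp => ?_⟩
    · rw [← hevC g]
      exact Ideal.mem_map_of_mem _ (Ideal.mem_sup_left (Ideal.mem_map_of_mem _ hg))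
    · rw [← hevL]
      exact Ideal.mem_map_of_mem _ (partialIdeal_mem _ _ hp)
  obtain ⟨y₀, hy₀, hy₀e⟩ := hlift _ hf
  -- The relation `l_i f ∈ J` is lifted to generic coefficients. The lift lies in the next generic
  -- ideal and specializes to zero, so up to a power of `F i` it has coefficients in `ker ev`.
  have hyJ : L i * map C f - y₀ ∈ partialIdeal G L (i.val + 1) := by
    rw [partialIdeal_succ]
    exact sub_mem (Ideal.mem_sup_right (Ideal.mul_mem_right _ _ (Ideal.mem_span_singleton_self _)))
      (Ideal.mem_sup_left hy₀)
  have hy0 : map ev (L i * map C f - y₀) = 0 := by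
    rw [map_sub, map_mul, hevC, hevL, hy₀e, sub_self]
  obtain ⟨M, hM⟩ := pow_mul_mem_smul_of_complement (hW i) (hJW i) ev hyJ hy0
  have hdecomp : ∀ z ∈ RingHom.ker ev •
      ((partialIdeal G L (i.val + 1)).restrictScalars (MvPolynomial (Fin s × Fin n) k)),
      ∃ g, map ev g = 0 ∧ z - L i * g ∈ partialIdeal G L i.val := by
    intro z hz
    refine Submodule.smul_induction_on hz ?_ ?_
    · intro c hc w hw
      rw [Submodule.restrictScalars_mem, partialIdeal_succ] at hw
      obtain ⟨u, hu, v, hv, rfl⟩ := Submodule.mem_sup.1 hw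
      obtain ⟨g, rfl⟩ := Ideal.mem_span_singleton'.1 hv
      refine ⟨C c * g, ?_, ?_⟩
      · rw [map_mul, map_C, hc, map_zero, zero_mul]
      · have : c • (u + g * L i) - L i * (C c * g) = C c * u := by
          rw [smul_eq_C_mul]; ring
        rw [this]
        exact Ideal.mul_mem_left _ _ hu
    · rintro z w ⟨g, hg, hgz⟩ ⟨g', hg', hgw⟩
      refine ⟨g + g', by rw [map_add, hg, hg', add_zero], ?_⟩
      have := add_mem hgz hgw
      convert this using 1
      ring
  obtain ⟨g, hg, hgM⟩ := hdecomp _ hM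
  -- Here `g` specializes to zero and `F i` to a unit, so the generic torsion statement for this
  -- element specializes to that for `f`.
  have hcolon : L i * (C (F i) ^ M * map C f - g) ∈ partialIdeal G L i.val := by
    have := add_mem hgM (Ideal.mul_mem_left _ (C (F i) ^ M) hy₀)
    convert this using 1
    ring
  obtain ⟨N, hN⟩ := generic_filter_regular hP i j _ hcolon
  refine ⟨N, ?_⟩
  have h1 := hmap _ _ hN
  rw [map_mul, map_pow, map_X, map_sub, map_mul, map_pow, map_C, hevC, hg, sub_zero] at h1
  have h2 := Ideal.mul_mem_left _ (C ((ev (F i))⁻¹ ^ M)) h1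
  convert h2 using 1
  have h3 : (C ((ev (F i))⁻¹ ^ M) * C (ev (F i)) ^ M : MvPolynomial (Fin n) k) = 1 := by
    rw [← C_pow, ← C_mul, ← mul_pow, inv_mul_cancel₀ hFi, one_pow, C_1]
  linear_combination (-(X j ^ N * f)) * h3

end Generic

/-! ### The iterated projection along linear forms -/

section IterProj

lemma isHomogeneous_linearForm {n : ℕ} (a : Fin n → k) : (linearForm a).IsHomogeneous 1 :=
  IsHomogeneous.sum _ _ _ fun i _ => isHomogeneous_C_mul_X (a i) i

lemma eq_linearForm {n : ℕ} {l : MvPolynomial (Fin n) k} (hl : l.IsHomogeneous 1) :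
    l = linearForm (linCoeff l) := by
  classical
  ext d
  by_cases hd : d.degree = 1
  · obtain ⟨i, rfl⟩ : ∃ i, d = Finsupp.single i 1 := by
      obtain ⟨i, hi⟩ := Multiset.card_eq_one.1 ((Finsupp.card_toMultiset d).trans hd)
      exact ⟨i, by rw [← Finsupp.toMultiset_toFinsupp d, hi, Multiset.toFinsupp_singleton]⟩
    exact (linCoeff_linearForm (linCoeff l) i).symm
  · rw [hl.coeff_eq_zero hd, (isHomogeneous_linearForm _).coeff_eq_zero hd]

lemma isHomogeneous_algHom {n r : ℕ} {ψ : MvPolynomial (Fin n) k →ₐ[k] MvPolynomial (Fin r) k}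
    (hψ : ∀ j, (ψ (X j)).IsHomogeneous 1) {f : MvPolynomial (Fin n) k} {m : ℕ}
    (hf : f.IsHomogeneous m) : (ψ f).IsHomogeneous m := by
  have := hf.aeval (fun j => ψ (X j)) hψ
  rwa [one_mul, ← show ψ = aeval fun j => ψ (X j) from aeval_unique ψ] at this

lemma homogeneousComponent_algHom {n r : ℕ}
    {ψ : MvPolynomial (Fin n) k →ₐ[k] MvPolynomial (Fin r) k}
    (hψ : ∀ j, (ψ (X j)).IsHomogeneous 1) (f : MvPolynomial (Fin n) k) (m : ℕ) :
    homogeneousComponent m (ψ f) = ψ (homogeneousComponent m f) := by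
  have := homogeneousComponent_aeval hψ f m
  rwa [← show ψ = aeval fun j => ψ (X j) from aeval_unique ψ] at this

lemma isHomogeneous_proj_X {m : ℕ} (l : MvPolynomial (Fin (m + 1)) k) (j : Fin (m + 1)) :
    (proj l (X j)).IsHomogeneous 1 := by
  rw [proj, aeval_X]
  refine Fin.lastCases ?_ (fun i => ?_) j
  · rw [Fin.snoc_last]
    exact IsHomogeneous.sum _ _ _ fun i _ => isHomogeneous_C_mul_X _ i
  · rw [Fin.snoc_castSucc]
    exact isHomogeneous_X k i

lemma proj_surjective {m : ℕ} (l : MvPolynomial (Fin (m + 1)) k) : Function.Surjective (proj l) :=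
  fun f => ⟨_, proj_rename l f⟩

lemma isHomogeneous_iterProj_X (s : ℕ) : ∀ (r : ℕ) (l : Fin s → MvPolynomial (Fin (r + s)) k)
    (j : Fin (r + s)), (iterProj s r l (X j)).IsHomogeneous 1 := by
  induction s with
  | zero => exact fun r l j => isHomogeneous_X k j
  | succ s ih =>
    intro r l j
    rw [iterProj, AlgHom.comp_apply]
    exact isHomogeneous_algHom (ih r _) (isHomogeneous_proj_X (m := r + s) (l 0) j)

lemma iterProj_surjective (s : ℕ) : ∀ (r : ℕ) (l : Fin s → MvPolynomial (Fin (r + s)) k),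
    Function.Surjective (iterProj s r l) := by
  induction s with
  | zero => exact fun r l => Function.surjective_id
  | succ s ih =>
    intro r l
    rw [iterProj, AlgHom.coe_comp]
    exact (ih r _).comp (proj_surjective (m := r + s) (l 0))

lemma ker_iterProj (s : ℕ) : ∀ (r : ℕ) (l : Fin s → MvPolynomial (Fin (r + s)) k),
    (∀ i, (l i).IsHomogeneous 1) → IterProjDefined s r l →
    RingHom.ker (iterProj s r l) = Ideal.span (Set.range l) := by
  induction s with
  | zero =>
    intro r l _ _
    rw [Set.range_eq_empty, Ideal.span_empty]
    exact (RingHom.injective_iff_ker_eq_bot _).1 Function.injective_id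
  | succ s ih =>
    intro r l hl hdef
    obtain ⟨h0, hdef⟩ := hdef
    set π := proj (m := r + s) (l 0) with hπ
    have hker : RingHom.ker π = Ideal.span {l 0} := by
      rw [hπ, eq_linearForm (hl 0)]
      exact ker_proj _ h0
    have h1 := ih r (fun i => π (l i.succ))
      (fun i => isHomogeneous_algHom (isHomogeneous_proj_X (m := r + s) (l 0)) (hl _)) hdef
    have h2 : RingHom.ker (iterProj (s + 1) r l) =
        (RingHom.ker (iterProj s r fun i => π (l i.succ))).comap π := rfl
    have h3 : Ideal.span (Set.range fun i : Fin s => π (l i.succ)) =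
        (Ideal.span (Set.range fun i : Fin s => l i.succ)).map π := by
      rw [Ideal.map_span, ← Set.range_comp]
      rfl
    rw [h2, h1, h3, Ideal.comap_map_of_surjective' _ (proj_surjective (m := r + s) (l 0)), hker,
      ← Ideal.span_union]
    congr 1
    ext x
    simp only [Set.mem_union, Set.mem_range, Set.mem_singleton_iff]
    constructor
    · rintro (⟨i, rfl⟩ | rfl)
      exacts [⟨_, rfl⟩, ⟨_, rfl⟩]
    · rintro ⟨i, rfl⟩
      refine Fin.cases (Or.inr rfl) (fun i => Or.inl ⟨i, rfl⟩) i

lemma linCoeff_C_mul {n : ℕ} (c : k) (l : MvPolynomial (Fin n) k) (i : Fin n) :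
    linCoeff (C c * l) i = c * linCoeff l i := coeff_C_mul _ _ _

lemma proj_C_mul {m : ℕ} {c : k} (hc : c ≠ 0) (l : MvPolynomial (Fin (m + 1)) k) :
    proj (C c * l) = proj l := by
  rw [proj, proj]
  congr 2
  refine Finset.sum_congr rfl fun i _ => ?_
  rw [linCoeff_C_mul, linCoeff_C_mul, mul_inv]
  congr 2
  field_simp

/-- Rescaling clears the denominator introduced by a projection, so that the nonvanishing conditions
become polynomial in the original coefficients. -/
lemma IterProjDefined.of_C_mul {c : k} (hc : c ≠ 0) (s : ℕ) :
    ∀ (r : ℕ) (l : Fin s → MvPolynomial (Fin (r + s)) k),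
    IterProjDefined s r (fun i => C c * l i) → IterProjDefined s r l := by
  induction s with
  | zero => exact fun _ _ _ => trivial
  | succ s ih =>
    intro r l h
    obtain ⟨h0, h⟩ := h
    rw [linCoeff_C_mul] at h0
    refine ⟨right_ne_zero_of_mul h0, ih r _ ?_⟩
    rw [proj_C_mul hc] at h
    simpa only [map_mul, algHom_C, algebraMap_eq] using h

lemma C_mul_proj_linearForm {m : ℕ} (a b : Fin (m + 1) → k) (ha : a (Fin.last m) ≠ 0) :
    C (a (Fin.last m)) * proj (linearForm a) (linearForm b) =
      linearForm fun i => a (Fin.last m) * b i.castSucc - b (Fin.last m) * a i.castSucc := by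
  have hb : linearForm b =
      ∑ i : Fin m, C (b i.castSucc) * X i.castSucc + C (b (Fin.last m)) * X (Fin.last m) :=
    Fin.sum_univ_castSucc _
  simp only [hb, proj, linCoeff_linearForm, map_add, map_sum, map_mul, aeval_X, algHom_C,
    Fin.snoc_castSucc, Fin.snoc_last, algebraMap_eq, Finset.mul_sum, ← Finset.sum_add_distrib,
    mul_add]
  refine Finset.sum_congr rfl fun i _ => ?_
  have h : a (Fin.last m) * (a (Fin.last m))⁻¹ = 1 := mul_inv_cancel₀ ha
  have h' := congrArg (C : k → MvPolynomial (Fin m) k) h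
  simp only [C_mul, C_1] at h'
  simp only [map_neg, C_sub, C_mul]
  linear_combination (-(C (b (Fin.last m)) * C (a i.castSucc) * X i)) * h'

/-- The iterated projection along general linear forms is defined. -/
theorem exists_forall_iterProjDefined (s r : ℕ) : ∃ F : MvPolynomial (Fin s × Fin (r + s)) k,
    F ≠ 0 ∧ ∀ a : Fin s → Fin (r + s) → k, eval (fun p => a p.1 p.2) F ≠ 0 →
      IterProjDefined s r (fun i => linearForm (a i)) := by
  suffices h : ∃ F : MvPolynomial (Fin s × Fin (r + s)) k,
      (∃ b : Fin s → Fin (r + s) → k, eval (fun p => b p.1 p.2) F ≠ 0) ∧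
      ∀ a : Fin s → Fin (r + s) → k, eval (fun p => a p.1 p.2) F ≠ 0 →
        IterProjDefined s r (fun i => linearForm (a i)) by
    obtain ⟨F, ⟨b, hb⟩, hF⟩ := h
    exact ⟨F, fun h0 => hb (by rw [h0, map_zero]), hF⟩
  induction s with
  | zero => exact ⟨1, ⟨fun _ _ => 0, by simp⟩, fun _ _ => trivial⟩
  | succ s ih =>
    obtain ⟨F, ⟨b, hb⟩, hF⟩ := ih
    let last : Fin (r + s + 1) := Fin.last (r + s)
    -- The coefficients of the projected forms, scaled by the last coefficient of the first form:
    -- two-by-two minors involving the last column.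
    let g : Fin s × Fin (r + s) → MvPolynomial (Fin (s + 1) × Fin (r + s + 1)) k := fun p =>
      X (0, last) * X (p.1.succ, p.2.castSucc) - X (p.1.succ, last) * X (0, p.2.castSucc)
    have heval : ∀ a : Fin (s + 1) → Fin (r + s + 1) → k,
        eval (fun p => a p.1 p.2) (X (0, last) * aeval g F) = a 0 last *
          eval (fun p : Fin s × Fin (r + s) => a 0 last * a p.1.succ p.2.castSucc -
            a p.1.succ last * a 0 p.2.castSucc) F := by
      intro a
      rw [map_mul, eval_X, ← coe_aeval_eq_eval, ← AlgHom.coe_toRingHom]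
      congr 1
      change (aeval fun p : Fin (s + 1) × Fin (r + s + 1) => a p.1 p.2) (aeval g F) = _
      rw [comp_aeval_apply, ← coe_aeval_eq_eval]
      simp [g]
    -- For the nonvanishing point the first form is the last variable and the others are the forms
    -- `b` not involving it; the minors are then the entries of `b`.
    refine ⟨X (0, last) * aeval g F, ⟨Fin.cons (Pi.single last 1) fun i => Fin.snoc (b i) 0, ?_⟩,
      fun a ha => ?_⟩
    · refine fun h0 => hb ?_
      have h1 := (heval _).symm.trans h0
      simpa [last] using h1
    · replace ha := fun h0 => ha ((heval a).trans h0)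
      have h0 : a 0 (Fin.last (r + s)) ≠ 0 := left_ne_zero_of_mul ha
      have h1 := hF (fun i j => a 0 last * a i.succ j.castSucc - a i.succ last * a 0 j.castSucc)
        (right_ne_zero_of_mul ha)
      refine ⟨?_, IterProjDefined.of_C_mul h0 s r _ ?_⟩
      · rw [linCoeff_linearForm]
        exact h0
      · convert h1 using 2 with i
        exact C_mul_proj_linearForm (m := r + s) (a 0) (a i.succ) h0

variable {n r : ℕ} {ψ : MvPolynomial (Fin n) k →ₐ[k] MvPolynomial (Fin r) k}

lemma comap_map_algHom (hs : Function.Surjective ψ) (P : Ideal (MvPolynomial (Fin n) k)) :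
    (P.map ψ).comap ψ = P ⊔ RingHom.ker ψ :=
  Ideal.comap_map_of_surjective' ψ hs P

lemma ringKrullDim_quotient_map (hs : Function.Surjective ψ)
    (P : Ideal (MvPolynomial (Fin n) k)) :
    ringKrullDim (MvPolynomial (Fin r) k ⧸ P.map ψ) =
      ringKrullDim (MvPolynomial (Fin n) k ⧸ (P ⊔ RingHom.ker ψ)) := by
  set θ : MvPolynomial (Fin n) k →+* MvPolynomial (Fin r) k ⧸ P.map ψ :=
    (Ideal.Quotient.mk (P.map ψ)).comp (ψ : _ →+* _) with hθ
  have hker : RingHom.ker θ = P ⊔ RingHom.ker ψ := by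
    rw [← comap_map_algHom hs]
    ext f
    simp [hθ, RingHom.mem_ker, Ideal.Quotient.eq_zero_iff_mem]
  have hsurj : Function.Surjective θ := Ideal.Quotient.mk_surjective.comp hs
  rw [← hker]
  exact ringKrullDim_eq_of_ringEquiv (RingHom.quotientKerEquivOfSurjective hsurj).symm

lemma hilbertFunction_map (hs : Function.Surjective ψ) (hψ : ∀ j, (ψ (X j)).IsHomogeneous 1)
    (P : Ideal (MvPolynomial (Fin n) k)) (m : ℕ) :
    hilbertFunction (P.map ψ) m = hilbertFunction (P ⊔ RingHom.ker ψ) m := by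
  set μ := (Ideal.Quotient.mkₐ k (P.map ψ)).toLinearMap ∘ₗ ψ.toLinearMap with hμ
  have h1 : (homogeneousSubmodule (Fin r) k m).map (Ideal.Quotient.mkₐ k (P.map ψ)).toLinearMap =
      (homogeneousSubmodule (Fin n) k m).map μ := by
    rw [hμ, Submodule.map_comp]
    congr 1
    ext f
    constructor
    · intro hf
      obtain ⟨g, rfl⟩ := hs f
      refine ⟨homogeneousComponent m g, homogeneousComponent_isHomogeneous _ _, ?_⟩
      rw [AlgHom.toLinearMap_apply, ← homogeneousComponent_algHom hψ,
        homogeneousComponent_eq_self hf]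
    · rintro ⟨g, hg, rfl⟩
      exact isHomogeneous_algHom hψ hg
  have h2 := LinearMap.finrank_range_add_finrank_ker
    (μ.domRestrict (homogeneousSubmodule (Fin n) k m))
  rw [LinearMap.range_domRestrict, ← h1] at h2
  have h3 := hilbertFunction_add (P ⊔ RingHom.ker ψ) m
  have h4 : (homogeneousSubmodule (Fin n) k m ⊓ (P ⊔ RingHom.ker ψ).restrictScalars k :
      Submodule k _) =
      (LinearMap.ker (μ.domRestrict (homogeneousSubmodule (Fin n) k m))).map
        (Submodule.subtype _) := by
    rw [← comap_map_algHom hs]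
    ext f
    simp only [Submodule.mem_inf, Submodule.restrictScalars_mem, mem_homogeneousSubmodule,
      Ideal.mem_comap, hμ, Submodule.mem_map, LinearMap.mem_ker, LinearMap.domRestrict_apply,
      Subtype.exists, Submodule.subtype_apply, exists_and_right, exists_eq_right,
      LinearMap.comp_apply, AlgHom.toLinearMap_apply,
      Ideal.Quotient.mkₐ_eq_mk, Ideal.Quotient.eq_zero_iff_mem, exists_prop]
  rw [h4, ← LinearEquiv.finrank_eq (Submodule.equivMapOfInjective _
    (Submodule.injective_subtype _) _)] at h3
  rw [hilbertFunction]
  omega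

end IterProj

/-! ### Hilbert series and dimension along a filter-regular sequence -/

section Chain

variable {n s : ℕ} {P : Ideal (MvPolynomial (Fin n) k)} {l : Fin s → MvPolynomial (Fin n) k}

lemma IsHomogeneousIdeal.partialIdeal (hP : IsHomogeneousIdeal P)
    (hl : ∀ i, (l i).IsHomogeneous 1) (i : ℕ) : IsHomogeneousIdeal (partialIdeal P l i) := by
  refine hP.sup (isHomogeneousIdeal_span ?_)
  rintro _ ⟨p, -, rfl⟩
  exact hl p

lemma partialIdeal_eq_sup_span_range : partialIdeal P l s = P ⊔ Ideal.span (Set.range l) := by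
  rw [partialIdeal]
  congr 2
  ext f
  exact ⟨fun ⟨p, _, h⟩ => ⟨p, h⟩, fun ⟨p, h⟩ => ⟨p, p.2, h⟩⟩

lemma partialIdeal_ne_top (hP : IsHomogeneousIdeal P) (hne : P ≠ ⊤)
    (hl : ∀ i, (l i).IsHomogeneous 1) (i : ℕ) : partialIdeal P l i ≠ ⊤ := by
  rw [Ne, Ideal.eq_top_iff_one] at hne ⊢
  intro h
  obtain ⟨a, ha, b, hb, hab⟩ := Submodule.mem_sup.1 h
  apply hne
  have hb0 : homogeneousComponent 0 b = 0 := by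
    refine Submodule.span_induction ?_ ?_ ?_ ?_ (p := fun b _ => homogeneousComponent 0 b = 0) hb
    · rintro _ ⟨p, -, rfl⟩
      rw [← mul_one (l p), homogeneousComponent_zero_mul (hl p)]
    · exact map_zero _
    · intro x y _ _ hx hy
      rw [map_add, hx, hy, add_zero]
    · intro c x _ hx
      rw [homogeneousComponent_zero] at hx ⊢
      rw [C_eq_zero] at hx ⊢
      rw [smul_eq_mul, ← constantCoeff_eq, map_mul, constantCoeff_eq, hx, mul_zero]
  have h1 : homogeneousComponent 0 (1 : MvPolynomial (Fin n) k) = 1 :=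
    homogeneousComponent_eq_self (isHomogeneous_one _ _)
  rw [← h1, ← hab, map_add, hb0, add_zero]
  exact isHomogeneousIdeal_iff.1 hP a ha 0

/-- The difference of the Hilbert series of `I` and `I : l` is a polynomial when the torsion
`(I : l) / I` has finite length. -/
lemma exists_hilbertSeries_sub_colon {I : Ideal (MvPolynomial (Fin n) k)}
    (hI : IsHomogeneousIdeal I) {l : MvPolynomial (Fin n) k} (hl : l.IsHomogeneous 1)
    (h : ∀ f, l * f ∈ I → ∀ j, ∃ N : ℕ, X j ^ N * f ∈ I) :
    ∃ T : Polynomial ℤ,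
      hilbertSeries (I ⊔ Ideal.span {l}) = hilbertSeries I * (1 - PowerSeries.X) +
        PowerSeries.X * (T : PowerSeries ℤ) ∧
      (T.eval 1 ≠ 0 → ∃ f, l * f ∈ I ∧ f ∉ I) := by
  obtain ⟨N, hN⟩ := exists_forall_mem_of_torsion (K := colonIdeal I l) hI fun f hf j => h f hf j
  -- `T` is the Hilbert series of `(I : l)/I`, a polynomial because the two ideals agree in large
  -- degrees.
  refine ⟨(PowerSeries.mk fun m => (hilbertFunction I m : ℤ) -
    hilbertFunction (colonIdeal I l) m).trunc N, ?_, ?_⟩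
  · rw [exists_polynomial_of_eventually_zero]
    · have h1 : (PowerSeries.mk fun m => (hilbertFunction I m : ℤ) -
          hilbertFunction (colonIdeal I l) m) =
          hilbertSeries I - hilbertSeries (colonIdeal I l) := by
        ext m; simp [hilbertSeries]
      rw [h1]
      linear_combination (-1 : PowerSeries ℤ) * hilbertSeries_eq hI hl
    · intro m hm
      rw [sub_eq_zero, Nat.cast_inj]
      exact hilbertFunction_congr fun f hf => ⟨fun hfI => le_colonIdeal I l hfI, hN m hm f hf⟩
  · contrapose!
    intro hall
    have h1 : colonIdeal I l = I := le_antisymm (fun f hf => hall f hf) (le_colonIdeal I l)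
    have h2 : (PowerSeries.mk fun m => (hilbertFunction I m : ℤ) -
        hilbertFunction (colonIdeal I l) m) = 0 := by
      ext m; simp [h1]
    rw [h2]
    simp

/-- The Hilbert series of `S / (P, l₁, …, l_{i+1})` for a filter-regular sequence. -/
theorem exists_hilbertSeries_partialIdeal (hP : IsHomogeneousIdeal P)
    (hl : ∀ i, (l i).IsHomogeneous 1) (hreg : IsFilterRegular P l) (i : Fin s) :
    ∃ G : Polynomial ℤ, hilbertSeries (partialIdeal P l (i.val + 1)) =
      hilbertSeries P * (1 - PowerSeries.X) ^ (i.val + 1) + (G : PowerSeries ℤ) ∧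
      (G.eval 1 ≠ 0 → ∃ f, l i * f ∈ partialIdeal P l i.val ∧ f ∉ partialIdeal P l i.val) := by
  have hstep : ∀ i : Fin s, ∀ G : Polynomial ℤ, hilbertSeries (partialIdeal P l i.val) =
      hilbertSeries P * (1 - PowerSeries.X) ^ i.val + (G : PowerSeries ℤ) →
      ∃ G : Polynomial ℤ, hilbertSeries (partialIdeal P l (i.val + 1)) =
      hilbertSeries P * (1 - PowerSeries.X) ^ (i.val + 1) + (G : PowerSeries ℤ) ∧
      (G.eval 1 ≠ 0 →
        ∃ f, l i * f ∈ partialIdeal P l i.val ∧ f ∉ partialIdeal P l i.val) := by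
    intro i G hG
    obtain ⟨T, hT, hT1⟩ := exists_hilbertSeries_sub_colon (hP.partialIdeal hl i.val) (hl i)
      (hreg i)
    -- The earlier error terms acquire the factor `1 - X`, so the value at `1` sees only the torsion
    -- of the last step.
    refine ⟨G * (1 - Polynomial.X) + Polynomial.X * T, ?_, fun h => hT1 ?_⟩
    · rw [partialIdeal_succ, hT, hG]
      push_cast
      ring
    · simpa using h
  suffices h : ∀ i : ℕ, i ≤ s → ∃ G : Polynomial ℤ, hilbertSeries (partialIdeal P l i) =
      hilbertSeries P * (1 - PowerSeries.X) ^ i + (G : PowerSeries ℤ) by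
    obtain ⟨G, hG⟩ := h i.val i.2.le
    exact hstep i G hG
  intro i
  induction i with
  | zero => exact fun _ => ⟨0, by simp [partialIdeal_zero]⟩
  | succ i ih =>
    intro hi
    obtain ⟨G, hG⟩ := ih (Nat.le_of_succ_le hi)
    obtain ⟨G', hG', -⟩ := hstep ⟨i, hi⟩ G hG
    exact ⟨G', hG'⟩

lemma IsParam.append {D : ℕ} {y : Fin D → MvPolynomial (Fin n) k}
    (hl : ∀ i, (l i).IsHomogeneous 1) (hy : IsParam (partialIdeal P l s) y) :
    IsParam P (Fin.append l y) := by
  refine ⟨fun j => ?_, hy.isIrrelevant.mono ?_⟩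
  · refine Fin.addCases (fun i => ?_) (fun i => ?_) j
    · rw [Fin.append_left]; exact hl i
    · rw [Fin.append_right]; exact hy.isHomogeneous i
  · refine sup_le (partialIdeal_le.2 ⟨le_sup_left, fun p _ => ?_⟩) (Ideal.span_le.2 ?_)
    · exact Ideal.mem_sup_right (Ideal.subset_span ⟨Fin.castAdd D p, Fin.append_left _ _ _⟩)
    · rintro _ ⟨p, rfl⟩
      exact Ideal.mem_sup_right (Ideal.subset_span ⟨Fin.natAdd s p, Fin.append_right _ _ _⟩)

theorem exists_hilbertSeries_numerator [Infinite k] (hP : IsHomogeneousIdeal P) (hne : P ≠ ⊤)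
    {d : ℕ} (hd : ringKrullDim (MvPolynomial (Fin n) k ⧸ P) = d) :
    ∃ q : Polynomial ℤ, (q : PowerSeries ℤ) = hilbertSeries P * (1 - PowerSeries.X) ^ d := by
  obtain ⟨D, hD, ⟨y, hy, -⟩, -⟩ := exists_isParam hP hne
  obtain rfl : D = d := by rw [hd] at hD; exact_mod_cast hD.symm
  exact hilbert_serre D P hP y hy.isHomogeneous hy.isIrrelevant

/-- A sequence of `s` linear forms changing the Hilbert series as expected drops the dimension by
`s`, and the forms are algebraically independent modulo `P`. -/
theorem ringKrullDim_partialIdeal [Infinite k] (hP : IsHomogeneousIdeal P) (hne : P ≠ ⊤)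
    (hl : ∀ i, (l i).IsHomogeneous 1) {d : ℕ}
    (hd : ringKrullDim (MvPolynomial (Fin n) k ⧸ P) = d) (hsd : s ≤ d) {G : Polynomial ℤ}
    (hG : hilbertSeries (partialIdeal P l s) =
      hilbertSeries P * (1 - PowerSeries.X) ^ s + (G : PowerSeries ℤ)) :
    ringKrullDim (MvPolynomial (Fin n) k ⧸ partialIdeal P l s) = (d - s : ℕ) ∧
      ∀ f : MvPolynomial (Fin s) k, aeval l f ∈ P → f = 0 := by
  obtain ⟨q, hq⟩ := exists_hilbertSeries_numerator hP hne hd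
  obtain ⟨D₀, hD₀, -, hmin⟩ := exists_isParam hP hne
  obtain rfl : D₀ = d := by rw [hd] at hD₀; exact_mod_cast hD₀.symm
  obtain ⟨D, hD, ⟨y, hy, hinj⟩, -⟩ := exists_isParam (hP.partialIdeal hl s)
    (partialIdeal_ne_top hP hne hl s)
  have happ := IsParam.append hl hy
  -- Appending parameters of the section to `l` gives parameters of `S/P`, of which there are at
  -- least `d`. The reverse bound comes from the order of the pole; then `l` is part of a minimal
  -- system and inherits algebraic independence.
  have h1 : D₀ ≤ s + D := by
    by_contra! h
    exact hmin _ h _ happ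
  have h2 : D ≤ D₀ - s := by
    refine le_of_hilbertSeries_mul hy.isHomogeneous hinj (D' := D₀ - s)
      (q := q + G * (1 - Polynomial.X) ^ (D₀ - s)) ?_
    push_cast
    rw [hq, hG, add_mul, mul_assoc, ← pow_add, show s + (D₀ - s) = D₀ by omega]
  have h3 : D = D₀ - s := by omega
  refine ⟨h3 ▸ hD, fun f hf => ?_⟩
  have h4 := happ.injective_of_minimal hP hne (fun D' hD' => hmin D' (by omega))
    (rename (Fin.castAdd D) f) (by
      rw [aeval_rename]
      convert hf using 2
      congr 1
      funext i
      exact Fin.append_left _ _ _)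
  exact (map_eq_zero_iff _ (rename_injective _ (Fin.castAdd_injective s D))).1 h4

end Chain

/-! ### Hilbert coefficients as Taylor coefficients at `1` -/

section Coefficients

variable {n : ℕ} {I : Ideal (MvPolynomial (Fin n) k)}

lemma hilbertNumerator_eq {D : ℕ} (hD : ringKrullDim (MvPolynomial (Fin n) k ⧸ I) = D)
    {q : Polynomial ℤ} (hq : (q : PowerSeries ℤ) = hilbertSeries I * (1 - PowerSeries.X) ^ D) :
    hilbertNumerator I = q := by
  have hdim : quotientDim I = D := by
    rw [quotientDim, hD]
    rfl
  have hex : ∃ q : Polynomial ℤ,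
      (q : PowerSeries ℤ) = hilbertSeries I * (1 - PowerSeries.X) ^ quotientDim I :=
    ⟨q, by rw [hq, hdim]⟩
  rw [hilbertNumerator, dif_pos hex]
  apply Polynomial.coe_injective
  rw [hex.choose_spec, hq, hdim]

/-- As `1 - t = -(t - 1)`, the second summand vanishes to order at least `e` at `1`, with
coefficient `(-1)^e G(1)` in order `e`. -/
lemma taylor_coeff_add (q G : Polynomial ℤ) (e i : ℕ) (hi : i ≤ e) :
    (Polynomial.taylor 1 (q + G * (1 - Polynomial.X) ^ e)).coeff i =
      (Polynomial.taylor 1 q).coeff i + if i = e then (-1) ^ e * G.eval 1 else 0 := by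
  have h1 : Polynomial.taylor 1 (1 - Polynomial.X : Polynomial ℤ) = - Polynomial.X := by
    simp [Polynomial.taylor_apply]
  rw [map_add, Polynomial.coeff_add, Polynomial.taylor_mul, Polynomial.taylor_pow, h1, neg_pow,
    ← mul_assoc, Polynomial.coeff_mul_X_pow']
  congr 1
  rcases hi.eq_or_lt with rfl | h
  · rw [if_pos le_rfl, if_pos rfl, Nat.sub_self]
    have : ((-1 : Polynomial ℤ) ^ i) = Polynomial.C ((-1) ^ i) := by simp
    rw [this, mul_comm, Polynomial.coeff_C_mul, Polynomial.taylor_coeff_zero]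
  · rw [if_neg (by omega), if_neg h.ne]

end Coefficients

/-! ### Counting in bounded degree -/

section BoundedDegree

/-- The exponents of total degree at most `i`. -/
def boundedExponents (s i : ℕ) : Finset (Fin s →₀ ℕ) :=
  (Finset.range (i + 1)).biUnion fun a => (Finset.univ : Finset (Fin s)).finsuppAntidiag a

lemma mem_boundedExponents {s i : ℕ} {α : Fin s →₀ ℕ} :
    α ∈ boundedExponents s i ↔ α.degree ≤ i := by
  simp [boundedExponents, Finset.mem_finsuppAntidiag, Finsupp.degree_eq_sum]

lemma card_boundedExponents (s i : ℕ) :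
    (boundedExponents s i).card = ∑ a ∈ Finset.range (i + 1), Nat.multichoose s a := by
  rw [boundedExponents, Finset.card_biUnion]
  · refine Finset.sum_congr rfl fun a _ => ?_
    rw [Finset.card_finsuppAntidiag_nat_eq_multichoose, Finset.card_univ, Fintype.card_fin]
  · intro a _ b _ hab
    rw [Function.onFun, Finset.disjoint_left]
    intro α ha hb
    rw [Finset.mem_finsuppAntidiag] at ha hb
    exact hab (ha.1.symm.trans hb.1)

lemma restrictTotalDegree_eq (s i : ℕ) : restrictTotalDegree (Fin s) k i =
    restrictSupport k (boundedExponents s i : Set (Fin s →₀ ℕ)) := by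
  rw [restrictTotalDegree]
  congr 1
  ext α
  rw [Finset.mem_coe, mem_boundedExponents]
  rfl

instance finiteDimensional_restrictTotalDegree (s i : ℕ) :
    FiniteDimensional k (restrictTotalDegree (Fin s) k i) := by
  rw [restrictTotalDegree_eq]
  exact Module.Finite.of_basis (basisRestrictSupport k _)

lemma finrank_restrictTotalDegree (s i : ℕ) :
    Module.finrank k (restrictTotalDegree (Fin s) k i) = (boundedExponents s i).card := by
  rw [restrictTotalDegree_eq, Module.finrank_eq_nat_card_basis (basisRestrictSupport k _)]
  simp

lemma mk_card_boundedExponents_mul (s : ℕ) :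
    (PowerSeries.mk fun i => ((boundedExponents s i).card : ℤ)) *
      (1 - PowerSeries.X) ^ (s + 1) = 1 := by
  have h : (PowerSeries.mk fun i => ((boundedExponents s i).card : ℤ)) =
      PowerSeries.mk fun i => ∑ a ∈ Finset.range (i + 1), (Nat.multichoose s a : ℤ) := by
    ext i
    simp [card_boundedExponents]
  rw [h, pow_succ', ← mul_assoc, mk_sum_range_mul, mk_multichoose_mul]

/-- Images of forms of different degrees are independent modulo a homogeneous ideal. Counting in
degrees at most `m` permits inhomogeneous relations later on. -/
lemma sum_hilbertFunction_le {n : ℕ} {I : Ideal (MvPolynomial (Fin n) k)}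
    (hI : IsHomogeneousIdeal I) (m : ℕ) : ∑ j ∈ Finset.range (m + 1), hilbertFunction I j ≤
      Module.finrank k
        ((restrictTotalDegree (Fin n) k m).map (Ideal.Quotient.mkₐ k I).toLinearMap) := by
  have hle : ∀ m, homogeneousSubmodule (Fin n) k m ≤ restrictTotalDegree (Fin n) k m :=
    fun m f hf => (mem_restrictTotalDegree _ _ _).2 (IsHomogeneous.totalDegree_le hf)
  induction m with
  | zero =>
    rw [Finset.sum_range_one]
    exact Submodule.finrank_mono (Submodule.map_mono (hle 0))
  | succ m ih =>
    rw [Finset.sum_range_succ]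
    set μ := (Ideal.Quotient.mkₐ k I).toLinearMap
    have h1 := Submodule.finrank_sup_add_finrank_inf_eq
      ((restrictTotalDegree (Fin n) k m).map μ) ((homogeneousSubmodule (Fin n) k (m + 1)).map μ)
    have h2 : (restrictTotalDegree (Fin n) k m).map μ ⊓
        (homogeneousSubmodule (Fin n) k (m + 1)).map μ = ⊥ := by
      rw [eq_bot_iff]
      rintro _ ⟨⟨f, hf, rfl⟩, ⟨g, hg, hfg⟩⟩
      rw [Submodule.mem_bot, ← hfg]
      have h3 : g - f ∈ I := Ideal.Quotient.eq.1 hfg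
      have h4 := isHomogeneousIdeal_iff.1 hI _ h3 (m + 1)
      rw [map_sub, homogeneousComponent_eq_self hg, homogeneousComponent_eq_zero, sub_zero] at h4
      · exact Ideal.Quotient.eq_zero_iff_mem.2 h4
      · exact Nat.lt_succ_of_le ((mem_restrictTotalDegree _ _ _).1 hf)
    rw [h2, finrank_bot, add_zero] at h1
    refine (Nat.add_le_add_right ih _).trans (h1.symm.le.trans (Submodule.finrank_mono ?_))
    rw [← Submodule.map_sup]
    refine Submodule.map_mono (sup_le (fun f hf => ?_) (hle _))
    rw [mem_restrictTotalDegree] at hf ⊢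
    omega

end BoundedDegree

/-! ### Saturated submodules of rank one -/

section RankOne

/-- A saturated submodule of rank at most one of a free module over a unique factorization
domain is cyclic. -/
lemma exists_generator_of_saturated {R B : Type*} [CommRing R] [IsDomain R]
    [UniqueFactorizationMonoid R] {Z : Submodule R (B →₀ R)}
    (hsat : ∀ ρ : R, ρ ≠ 0 → ∀ v, ρ • v ∈ Z → v ∈ Z)
    (hdep : ∀ v ∈ Z, ∀ w ∈ Z, ∃ ρ σ : R, (ρ ≠ 0 ∨ σ ≠ 0) ∧ ρ • v + σ • w = 0) :
    ∃ w ∈ Z, ∀ v ∈ Z, ∃ ρ : R, v = ρ • w := by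
  classical
  by_cases hZ : Z = ⊥
  · exact ⟨0, Z.zero_mem, fun v hv => ⟨0, by simpa [hZ] using hv⟩⟩
  obtain ⟨z, hz, hz0⟩ := Submodule.exists_mem_ne_zero_of_ne_bot hZ
  let _ : StrongNormalizationMonoid R := UniqueFactorizationMonoid.strongNormalizationMonoid
  let _ : NormalizedGCDMonoid R := UniqueFactorizationMonoid.toNormalizedGCDMonoid R
  -- Dividing a nonzero element by the gcd of its coordinates gives a primitive `w`, which stays in
  -- `Z` by saturation.
  obtain ⟨g, hg, hg1⟩ := Finset.extract_gcd z (Finsupp.support_nonempty_iff.2 hz0)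
  set w : B →₀ R := Finsupp.indicator z.support fun b _ => g b with hw
  have hwb : ∀ b ∈ z.support, w b = g b := fun b hb => by
    rw [hw, Finsupp.indicator_of_mem hb]
  have hzw : z = z.support.gcd z • w := by
    ext b
    rw [Finsupp.smul_apply, smul_eq_mul]
    by_cases hb : b ∈ z.support
    · rw [hwb b hb, hg b hb]
    · rw [hw, Finsupp.indicator_of_notMem hb, mul_zero, Finsupp.notMem_support_iff.1 hb]
  have hgcd : z.support.gcd z ≠ 0 := fun h => hz0 (by rw [hzw, h, zero_smul])
  have hwZ : w ∈ Z := hsat _ hgcd _ (hzw ▸ hz)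
  have hw0 : w ≠ 0 := fun h => hz0 (by rw [hzw, h, smul_zero])
  refine ⟨w, hwZ, fun v hv => ?_⟩
  obtain ⟨ρ, σ, hne, hrel⟩ := hdep v hv w hwZ
  have hρ : ρ ≠ 0 := by
    rintro rfl
    rw [zero_smul, zero_add, smul_eq_zero] at hrel
    exact hrel.elim (hne.resolve_left (fun h => h rfl)) hw0
  -- `ρ` divides `σ` times every coordinate of `w`, hence `σ` times their gcd, which is `1`.
  have hdvd : ρ ∣ σ := by
    have h1 : ∀ b ∈ z.support, ρ ∣ σ * g b := by
      intro b hb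
      have h2 := DFunLike.congr_fun hrel b
      simp only [Finsupp.add_apply, Finsupp.smul_apply, smul_eq_mul, Finsupp.zero_apply,
        hwb b hb] at h2
      exact ⟨-v b, by linear_combination h2⟩
    have h2 := Finset.dvd_gcd h1
    have h3 := (Finset.gcd_mul_left' (s := z.support) (f := g) (a := σ)).dvd
    rw [hg1, mul_one] at h3
    exact h2.trans h3
  obtain ⟨c, rfl⟩ := hdvd
  refine ⟨-c, ?_⟩
  have h1 : ρ • (v + c • w) = 0 := by rw [smul_add, smul_smul, hrel]
  have h2 := (smul_eq_zero.1 h1).resolve_left hρ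
  rw [neg_smul]
  exact eq_neg_of_add_eq_zero_left h2

end RankOne

/-! ### Primes generated by variables -/

section VariableIdeals

variable {s : ℕ}

/-- Killing the first `j` variables. -/
def killVars (k : Type*) [Field k] (s j : ℕ) :
    MvPolynomial (Fin s) k →ₐ[k] MvPolynomial (Fin s) k :=
  aeval fun p => if p.val < j then 0 else X p

lemma ker_killVars (j : ℕ) :
    RingHom.ker (killVars k s j) = partialIdeal ⊥ (X : Fin s → MvPolynomial (Fin s) k) j := by
  set q := partialIdeal ⊥ (X : Fin s → MvPolynomial (Fin s) k) j
  apply le_antisymm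
  · have h : (Ideal.Quotient.mkₐ k q).comp (killVars k s j) = Ideal.Quotient.mkₐ k q := by
      apply algHom_ext
      intro p
      rw [AlgHom.comp_apply, killVars, aeval_X]
      split_ifs with hp
      · rw [map_zero]
        exact (Ideal.Quotient.eq_zero_iff_mem.2 (partialIdeal_mem _ _ hp)).symm
      · rfl
    intro f hf
    have h2 := DFunLike.congr_fun h f
    rw [AlgHom.comp_apply, (RingHom.mem_ker).1 hf, map_zero] at h2
    exact Ideal.Quotient.eq_zero_iff_mem.1 h2.symm
  · refine partialIdeal_le.2 ⟨bot_le, fun p hp => ?_⟩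
    rw [RingHom.mem_ker, killVars, aeval_X, if_pos hp]

lemma partialIdeal_X_isPrime (j : ℕ) :
    (partialIdeal ⊥ (X : Fin s → MvPolynomial (Fin s) k) j).IsPrime := by
  rw [← ker_killVars]
  exact RingHom.ker_isPrime _

lemma X_notMem_partialIdeal (p : Fin s) :
    X p ∉ partialIdeal ⊥ (X : Fin s → MvPolynomial (Fin s) k) p.val := by
  rw [← ker_killVars, RingHom.mem_ker, killVars, aeval_X, if_neg (lt_irrefl _)]
  exact X_ne_zero p

end VariableIdeals

/-! ### Cyclic relations and regular sequences -/

section Presentation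

variable {n s : ℕ} {B : Type*} (l : Fin s → MvPolynomial (Fin n) k)
  (e : B → MvPolynomial (Fin n) k)

/-- The map from a free module over `k[y₁, …, y_s]` to `S` given by `y_i ↦ l_i` and a family of
elements of `S`. -/
def presentation : (B →₀ MvPolynomial (Fin s) k) →ₗ[k] MvPolynomial (Fin n) k :=
  Finsupp.lsum k fun b => (LinearMap.mulRight k (e b)).comp (aeval l).toLinearMap

lemma presentation_single (b : B) (ρ : MvPolynomial (Fin s) k) :
    presentation l e (Finsupp.single b ρ) = aeval l ρ * e b := by
  simp [presentation]

lemma presentation_smul (ρ : MvPolynomial (Fin s) k) (v : B →₀ MvPolynomial (Fin s) k) :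
    presentation l e (ρ • v) = aeval l ρ * presentation l e v := by
  induction v using Finsupp.induction_linear with
  | zero => simp
  | add v w hv hw => rw [smul_add, map_add, map_add, hv, hw, mul_add]
  | single b σ =>
    rw [Finsupp.smul_single, presentation_single, presentation_single, smul_eq_mul, map_mul,
      mul_assoc]

/-- The relations modulo `P`. -/
def relations (P : Ideal (MvPolynomial (Fin n) k)) :
    Submodule (MvPolynomial (Fin s) k) (B →₀ MvPolynomial (Fin s) k) where
  carrier := {v | presentation l e v ∈ P}
  zero_mem' := by simp
  add_mem' hv hw := by
    rw [Set.mem_ofPred_eq, map_add]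
    exact P.add_mem hv hw
  smul_mem' ρ v hv := by
    rw [Set.mem_ofPred_eq, presentation_smul]
    exact P.mul_mem_left _ hv

variable {l e} {P : Ideal (MvPolynomial (Fin n) k)}

lemma mem_relations {v : B →₀ MvPolynomial (Fin s) k} :
    v ∈ relations l e P ↔ presentation l e v ∈ P := Iff.rfl

lemma presentation_mem_partialIdeal {j : ℕ} {v : B →₀ MvPolynomial (Fin s) k}
    (hv : ∀ b, v b ∈ partialIdeal ⊥ (X : Fin s → MvPolynomial (Fin s) k) j) :
    presentation l e v ∈ partialIdeal P l j := by
  have h : partialIdeal ⊥ (X : Fin s → MvPolynomial (Fin s) k) j ≤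
      (partialIdeal P l j).comap (aeval l) := by
    refine partialIdeal_le.2 ⟨bot_le, fun p hp => ?_⟩
    rw [Ideal.mem_comap, aeval_X]
    exact partialIdeal_mem P l hp
  rw [presentation, Finsupp.lsum_apply]
  exact Ideal.sum_mem _ fun b _ => Ideal.mul_mem_right _ _ (h (hv b))

lemma exists_presentation_of_mem_partialIdeal
    (hsurj : ∀ f, ∃ v, f - presentation l e v ∈ P) {j : ℕ} (hj : j ≤ s)
    {f : MvPolynomial (Fin n) k} (hf : f ∈ partialIdeal P l j) :
    ∃ v, (∀ b, v b ∈ partialIdeal ⊥ (X : Fin s → MvPolynomial (Fin s) k) j) ∧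
      f - presentation l e v ∈ P := by
  induction j generalizing f with
  | zero =>
    rw [partialIdeal_zero] at hf
    exact ⟨0, fun b => Ideal.zero_mem _, by simpa using hf⟩
  | succ j ih =>
    rw [partialIdeal_succ P l ⟨j, hj⟩] at hf
    obtain ⟨f', hf', g', hg', rfl⟩ := Submodule.mem_sup.1 hf
    obtain ⟨g, rfl⟩ := Ideal.mem_span_singleton'.1 hg'
    obtain ⟨v, hv, hfv⟩ := ih (Nat.le_of_succ_le hj) hf'
    obtain ⟨u, hu⟩ := hsurj g
    refine ⟨v + (X ⟨j, hj⟩ : MvPolynomial (Fin s) k) • u, fun b => ?_, ?_⟩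
    · rw [partialIdeal_succ ⊥ X ⟨j, hj⟩]
      exact add_mem (Ideal.mem_sup_left (hv b)) (Ideal.mem_sup_right
        (Ideal.mul_mem_right _ _ (Ideal.mem_span_singleton_self _)))
    · rw [map_add, presentation_smul, aeval_X]
      have := add_mem hfv (P.mul_mem_left (l ⟨j, hj⟩) hu)
      convert this using 1
      ring

/-- If the relations are generated by one element and the last of the forms is a zerodivisor
modulo the previous ones, then the previous ones form a regular sequence. -/
lemma mem_partialIdeal_of_cyclic_relations
    (hsurj : ∀ f, ∃ v, f - presentation l e v ∈ P) {w : B →₀ MvPolynomial (Fin s) k}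
    (hw : w ∈ relations l e P)
    (hgen : ∀ v ∈ relations l e P, ∃ ρ : MvPolynomial (Fin s) k, v = ρ • w)
    {t : Fin s} {h : MvPolynomial (Fin n) k} (hth : l t * h ∈ partialIdeal P l t.val)
    (hh : h ∉ partialIdeal P l t.val) (i : Fin s) (hi : i < t) {f : MvPolynomial (Fin n) k}
    (hf : l i * f ∈ partialIdeal P l i.val) : f ∈ partialIdeal P l i.val := by
  -- Lifted to the free module, `l_i f ∈ J` says that `X i • v` is a relation modulo `(X_p : p <
  -- i)`, and every relation is a multiple of `w`.
  have key : ∀ (i : Fin s) (f : MvPolynomial (Fin n) k), l i * f ∈ partialIdeal P l i.val →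
      ∃ (v : B →₀ MvPolynomial (Fin s) k) (ρ : MvPolynomial (Fin s) k),
        f - presentation l e v ∈ P ∧ ∀ b, X i * v b - ρ * w b ∈
          partialIdeal ⊥ (X : Fin s → MvPolynomial (Fin s) k) i.val := by
    intro i f hf
    obtain ⟨v, hv⟩ := hsurj f
    obtain ⟨u, hu, hfu⟩ := exists_presentation_of_mem_partialIdeal hsurj i.2.le hf
    have hrel : (X i : MvPolynomial (Fin s) k) • v - u ∈ relations l e P := by
      rw [mem_relations, map_sub, presentation_smul, aeval_X]
      have := sub_mem hfu (P.mul_mem_left (l i) hv)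
      convert this using 1
      ring
    obtain ⟨ρ, hρ⟩ := hgen _ hrel
    refine ⟨v, ρ, hv, fun b => ?_⟩
    have h1 := DFunLike.congr_fun hρ b
    simp only [Finsupp.sub_apply, Finsupp.smul_apply, smul_eq_mul] at h1
    rw [← h1, sub_sub_cancel]
    exact hu b
  have hP : P ≤ partialIdeal P l i.val := le_sup_left
  -- Otherwise `X t • v` would have all coordinates in the prime `(X_p : p < t)`, hence so would
  -- `v`, forcing `h` into the ideal.
  have hwt : ¬ ∀ b, w b ∈ partialIdeal ⊥ (X : Fin s → MvPolynomial (Fin s) k) t.val := by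
    intro hwt
    obtain ⟨v, ρ, hv, hvb⟩ := key t h hth
    have h1 : ∀ b, v b ∈ partialIdeal ⊥ (X : Fin s → MvPolynomial (Fin s) k) t.val := by
      intro b
      have h2 := add_mem (hvb b) (Ideal.mul_mem_left _ ρ (hwt b))
      rw [sub_add_cancel] at h2
      exact ((partialIdeal_X_isPrime _).mem_or_mem h2).resolve_left (X_notMem_partialIdeal t)
    apply hh
    have h2 := add_mem (Ideal.mem_sup_left hv) (presentation_mem_partialIdeal (P := P) (l := l)
      (e := e) h1)
    rwa [sub_add_cancel] at h2
  obtain ⟨v, ρ, hv, hvb⟩ := key i f hf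
  -- `ρ • w` vanishes modulo the prime `(X_p : p ≤ i)`. Since `i < t`, this prime is contained in
  -- `(X_p : p < t)`, so some coordinate of `w` lies outside it.
  have hρ : ρ ∈ partialIdeal ⊥ (X : Fin s → MvPolynomial (Fin s) k) (i.val + 1) := by
    by_contra hρ
    apply hwt
    intro b
    have h1 : ρ * w b ∈ partialIdeal ⊥ (X : Fin s → MvPolynomial (Fin s) k) (i.val + 1) := by
      rw [partialIdeal_succ]
      have h2 : X i * v b ∈ partialIdeal ⊥ (X : Fin s → MvPolynomial (Fin s) k) i.val ⊔
          Ideal.span {X i} :=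
        Ideal.mem_sup_right (Ideal.mul_mem_right _ _ (Ideal.mem_span_singleton_self _))
      have h3 := sub_mem h2 (Ideal.mem_sup_left (hvb b))
      rwa [sub_sub_cancel] at h3
    have h2 := ((partialIdeal_X_isPrime _).mem_or_mem h1).resolve_left hρ
    refine (partialIdeal_le.2 ⟨bot_le, fun p hp => partialIdeal_mem _ _ ?_⟩ :
      _ ≤ partialIdeal ⊥ X t.val) h2
    exact lt_of_lt_of_le hp (Nat.succ_le_of_lt hi)
  rw [partialIdeal_succ] at hρ
  obtain ⟨ρ₁, hρ₁, ρ₂, hρ₂, rfl⟩ := Submodule.mem_sup.1 hρ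
  obtain ⟨c, rfl⟩ := Ideal.mem_span_singleton'.1 hρ₂
  -- With `ρ = ρ₁ + c X i`, subtracting the relation `c • w` from `v` does not change its class in
  -- `S/P`, and `X i` can then be cancelled modulo the prime.
  have h1 : ∀ b, (v - c • w) b ∈ partialIdeal ⊥ (X : Fin s → MvPolynomial (Fin s) k) i.val := by
    intro b
    have h2 : X i * (v b - c * w b) ∈
        partialIdeal ⊥ (X : Fin s → MvPolynomial (Fin s) k) i.val := by
      have := add_mem (hvb b) (Ideal.mul_mem_right (w b) _ hρ₁)
      convert this using 1
      ring
    exact ((partialIdeal_X_isPrime _).mem_or_mem h2).resolve_left (X_notMem_partialIdeal i)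
  have h2 := presentation_mem_partialIdeal (P := P) (l := l) (e := e) h1
  rw [map_sub, presentation_smul] at h2
  have h3 := add_mem (add_mem h2 (hP (P.mul_mem_left (aeval l c) (mem_relations.1 hw)))) (hP hv)
  convert h3 using 1
  ring

end Presentation

/-! ### The degree filtration of the free module -/

section Filtration

variable {s : ℕ} {a : ℕ → ℕ}

/-- The elements of degree at most `m` of the free module with `a j` generators in degree `j`. -/
def degreeLE (k : Type*) [Field k] (s : ℕ) (a : ℕ → ℕ) (m : ℕ) :
    Submodule k ((Σ j, Fin (a j)) →₀ MvPolynomial (Fin s) k) where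
  carrier := {v | ∀ b, ∀ α ∈ (v b).support, b.1 + α.degree ≤ m}
  zero_mem' := by simp
  add_mem' {v w} hv hw b α hα := by
    classical
    rw [Finsupp.add_apply] at hα
    rcases Finset.mem_union.1 (support_add hα) with h | h
    · exact hv b α h
    · exact hw b α h
  smul_mem' c v hv b α hα := by
    rw [Finsupp.smul_apply] at hα
    exact hv b α (support_smul hα)

lemma degreeLE_mono {m m' : ℕ} (h : m ≤ m') : degreeLE k s a m ≤ degreeLE k s a m' :=
  fun _ hv b α hα => (hv b α hα).trans h

lemma smul_mem_degreeLE {i m : ℕ} {ρ : MvPolynomial (Fin s) k} (hρ : ρ.totalDegree ≤ i)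
    {v : (Σ j, Fin (a j)) →₀ MvPolynomial (Fin s) k} (hv : v ∈ degreeLE k s a m) :
    ρ • v ∈ degreeLE k s a (m + i) := by
  classical
  intro b α hα
  rw [Finsupp.smul_apply, smul_eq_mul] at hα
  obtain ⟨β, hβ, γ, hγ, rfl⟩ := Finset.mem_add.1 (support_mul _ _ hα)
  have h1 : β.degree ≤ ρ.totalDegree := by
    rw [Finsupp.degree_eq_sum]
    have := le_totalDegree hβ
    rwa [Finsupp.sum_fintype _ _ (fun _ => rfl)] at this
  have h2 := hv b γ hγ
  rw [map_add]
  omega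

lemma exists_mem_degreeLE (v : (Σ j, Fin (a j)) →₀ MvPolynomial (Fin s) k) :
    ∃ m, v ∈ degreeLE k s a m := by
  induction v using Finsupp.induction_linear with
  | zero => exact ⟨0, zero_mem _⟩
  | add v w hv hw =>
    obtain ⟨m, hm⟩ := hv
    obtain ⟨m', hm'⟩ := hw
    exact ⟨max m m', add_mem (degreeLE_mono (le_max_left _ _) hm)
      (degreeLE_mono (le_max_right _ _) hm')⟩
  | single b ρ =>
    refine ⟨b.1 + ρ.support.sup Finsupp.degree, fun b' α hα => ?_⟩
    by_cases h : b = b'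
    · subst h
      rw [Finsupp.single_eq_same] at hα
      exact Nat.add_le_add_left (Finset.le_sup hα) _
    · rw [Finsupp.single_eq_of_ne' h] at hα
      simp at hα

/-- The indices of the monomials of degree at most `m` of the free module. -/
def monomialIndices (s : ℕ) (a : ℕ → ℕ) (m : ℕ) :
    Finset (Σ j, Fin (a j) × (Fin s →₀ ℕ)) :=
  (Finset.range (m + 1)).sigma fun j => Finset.univ ×ˢ boundedExponents s (m - j)

lemma card_monomialIndices (s : ℕ) (a : ℕ → ℕ) (m : ℕ) : (monomialIndices s a m).card =
    ∑ j ∈ Finset.range (m + 1), a j * (boundedExponents s (m - j)).card := by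
  simp [monomialIndices, Finset.card_sigma]

/-- The coefficients of the monomials of degree at most `m`. -/
def degreeLECoeff (k : Type*) [Field k] (s : ℕ) (a : ℕ → ℕ) (m : ℕ) :
    degreeLE k s a m →ₗ[k] (monomialIndices s a m → k) where
  toFun v p := coeff p.1.2.2 (v.1 ⟨p.1.1, p.1.2.1⟩)
  map_add' v w := by ext p; simp
  map_smul' c v := by ext p; simp

lemma degreeLECoeff_injective (m : ℕ) : Function.Injective (degreeLECoeff k s a m) := by
  refine (injective_iff_map_eq_zero _).2 fun v hv => ?_
  ext b α
  by_contra hne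
  have hα : α ∈ (v.1 b).support := mem_support_iff.2 hne
  have hle := v.2 b α hα
  apply hne
  have hmem : (⟨b.1, b.2, α⟩ : Σ j, Fin (a j) × (Fin s →₀ ℕ)) ∈ monomialIndices s a m := by
    rw [monomialIndices, Finset.mem_sigma, Finset.mem_product]
    refine ⟨Finset.mem_range.2 ?_, Finset.mem_univ _, mem_boundedExponents.2 ?_⟩
    · change b.1 < m + 1
      omega
    · change α.degree ≤ m - b.1
      omega
  exact congrFun hv ⟨_, hmem⟩

instance finiteDimensional_degreeLE (m : ℕ) : FiniteDimensional k (degreeLE k s a m) :=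
  Module.Finite.of_injective _ (degreeLECoeff_injective m)

lemma finrank_degreeLE_le (m : ℕ) : Module.finrank k (degreeLE k s a m) ≤
    ∑ j ∈ Finset.range (m + 1), a j * (boundedExponents s (m - j)).card := by
  have h := LinearMap.finrank_le_finrank_of_injective (degreeLECoeff_injective (k := k) (s := s)
    (a := a) m)
  rwa [Module.finrank_fintype_fun_eq_card, Fintype.card_coe, card_monomialIndices] at h

end Filtration

/-! ### Generators of `S/P` over the polynomial ring and the rank of the relations -/

section MinimalGenerators

variable {n s : ℕ} {P : Ideal (MvPolynomial (Fin n) k)} {l : Fin s → MvPolynomial (Fin n) k}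

/-- Homogeneous lifts of a basis of `S / J`. -/
lemma exists_homogeneous_lifts (J : Ideal (MvPolynomial (Fin n) k)) :
    ∃ e : (Σ m, Fin (hilbertFunction J m)) → MvPolynomial (Fin n) k,
      (∀ b, (e b).IsHomogeneous b.1) ∧ ∀ m f, f.IsHomogeneous m →
        ∃ c : Fin (hilbertFunction J m) → k, f - ∑ i, c i • e ⟨m, i⟩ ∈ J := by
  set μ := (Ideal.Quotient.mkₐ k J).toLinearMap
  let bas := fun m => Module.finBasis k ((homogeneousSubmodule (Fin n) k m).map μ)
  have h : ∀ b : (Σ m, Fin (hilbertFunction J m)), ∃ f : MvPolynomial (Fin n) k,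
      f.IsHomogeneous b.1 ∧ μ f = (bas b.1 b.2).1 := by
    intro b
    obtain ⟨f, hf, hfb⟩ := (bas b.1 b.2).2
    exact ⟨f, hf, hfb⟩
  choose e he hμ using h
  refine ⟨e, he, fun m f hf => ?_⟩
  set x : (homogeneousSubmodule (Fin n) k m).map μ := ⟨μ f, f, hf, rfl⟩
  refine ⟨(bas m).repr x, Ideal.Quotient.eq.1 ?_⟩
  have h1 := congrArg Subtype.val ((bas m).sum_repr x)
  change μ f = μ (∑ i, (bas m).repr x i • e ⟨m, i⟩)
  rw [map_sum]
  change _ = μ f at h1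
  rw [← h1, Submodule.coe_sum]
  refine Finset.sum_congr rfl fun i _ => ?_
  rw [map_smul, hμ ⟨m, i⟩]
  rfl

variable {J : Ideal (MvPolynomial (Fin n) k)}
  {e : (Σ m, Fin (hilbertFunction J m)) → MvPolynomial (Fin n) k}

/-- Graded Nakayama, with degrees tracked: the lifted basis of `S/J` generates `S/P` over the
polynomial ring in `l`, without needing elements of higher degree in the free module. -/
lemma mem_map_degreeLE (hP : IsHomogeneousIdeal P) (hJ : J ≤ P ⊔ Ideal.span (Set.range l))
    (hl : ∀ i, (l i).IsHomogeneous 1)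
    (he : ∀ b, (e b).IsHomogeneous b.1)
    (hspan : ∀ m f, f.IsHomogeneous m → ∃ c : Fin (hilbertFunction J m) → k,
      f - ∑ i, c i • e ⟨m, i⟩ ∈ J) (m : ℕ) (f : MvPolynomial (Fin n) k)
    (hf : f.totalDegree ≤ m) :
    f ∈ (degreeLE k s (hilbertFunction J) m).map (presentation l e) ⊔
      P.restrictScalars k := by
  set M : ℕ → Submodule k (MvPolynomial (Fin n) k) := fun m =>
    (degreeLE k s (hilbertFunction J) m).map (presentation l e) ⊔
      P.restrictScalars k
  have hM : ∀ m m', m ≤ m' → M m ≤ M m' := fun m m' h =>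
    sup_le_sup_right (Submodule.map_mono (degreeLE_mono h)) _
  have hhom : ∀ m f, f.IsHomogeneous m → f ∈ M m := by
    refine graded_nakayama hP hl M (fun m f hf _ => Submodule.mem_sup_right hf) ?_ ?_
    · intro m j f hf
      obtain ⟨_, ⟨v, hv, rfl⟩, g, hg, rfl⟩ := Submodule.mem_sup.1 hf
      rw [mul_add]
      refine add_mem (Submodule.mem_sup_left ⟨(X j : MvPolynomial (Fin s) k) • v, ?_, ?_⟩)
        (Submodule.mem_sup_right (P.mul_mem_left _ hg))
      · exact smul_mem_degreeLE (totalDegree_X j).le hv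
      · rw [presentation_smul, aeval_X]
    · intro m f hf
      obtain ⟨c, hc⟩ := hspan m f hf
      refine ⟨_, ?_, ?_, hJ hc⟩
      · refine sum_mem fun i _ => Submodule.smul_mem _ _ (Submodule.mem_sup_left
          ⟨Finsupp.single ⟨m, i⟩ 1, ?_, ?_⟩)
        · intro b α hα
          by_cases h : (⟨m, i⟩ : Σ m, Fin (hilbertFunction J m)) = b
          · subst h
            rw [Finsupp.single_eq_same] at hα
            have hα0 : α = 0 := by
              classical
              by_contra h0
              rw [mem_support_iff, coeff_one, if_neg (Ne.symm h0)] at hα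
              exact hα rfl
            simp [hα0]
          · rw [Finsupp.single_eq_of_ne' h] at hα
            simp at hα
        · rw [presentation_single, map_one, one_mul]
      · exact (homogeneousSubmodule (Fin n) k m).sum_mem fun i _ =>
          Submodule.smul_mem _ _ (he ⟨m, i⟩)
  rw [← sum_homogeneousComponent f]
  refine sum_mem fun i hi => hM i m ?_ (hhom i _ (homogeneousComponent_isHomogeneous i f))
  have := Finset.mem_range.1 hi
  omega

/-- Rank-nullity on `D`: the image contains `A` and the kernel contains a copy of `U`. -/
lemma finrank_add_le_of_le_map {K V Q U : Type*} [Field K] [AddCommGroup V] [Module K V]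
    [AddCommGroup Q] [Module K Q] [AddCommGroup U] [Module K U] {φ : V →ₗ[K] Q}
    {D : Submodule K V} [FiniteDimensional K D] {A : Submodule K Q} (hA : A ≤ D.map φ)
    {θ : U →ₗ[K] V} (hθ : Function.Injective θ) (hD : ∀ u, θ u ∈ D) (hφ : ∀ u, φ (θ u) = 0) :
    Module.finrank K A + Module.finrank K U ≤ Module.finrank K D := by
  have h1 := LinearMap.finrank_range_add_finrank_ker (φ.domRestrict D)
  rw [LinearMap.range_domRestrict] at h1
  have h2 := Submodule.finrank_mono hA
  have h3 := LinearMap.finrank_le_finrank_of_injective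
    (f := (θ.codRestrict D hD).codRestrict (LinearMap.ker (φ.domRestrict D)) fun u => hφ u)
    fun u v huv => hθ (congrArg (fun x => ((x : LinearMap.ker (φ.domRestrict D)) : D).1) huv)
  omega

/-- If two relations are linearly independent, the error term of the Hilbert series has value at
least two at `1`. -/
lemma exists_relation_of_eval_lt_two (hP : IsHomogeneousIdeal P)
    (hJ : J ≤ P ⊔ Ideal.span (Set.range l))
    (hl : ∀ i, (l i).IsHomogeneous 1) (he : ∀ b, (e b).IsHomogeneous b.1)
    (hspan : ∀ m f, f.IsHomogeneous m → ∃ c : Fin (hilbertFunction J m) → k,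
      f - ∑ i, c i • e ⟨m, i⟩ ∈ J)
    {G : Polynomial ℤ} (hG : hilbertSeries J =
      hilbertSeries P * (1 - PowerSeries.X) ^ s + (G : PowerSeries ℤ)) (hG1 : G.eval 1 < 2)
    {z₁ z₂ : (Σ m, Fin (hilbertFunction J m)) →₀ MvPolynomial (Fin s) k}
    (hz₁ : z₁ ∈ relations l e P) (hz₂ : z₂ ∈ relations l e P) :
    ∃ ρ σ : MvPolynomial (Fin s) k, (ρ ≠ 0 ∨ σ ≠ 0) ∧ ρ • z₁ + σ • z₂ = 0 := by
  by_contra! hind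
  set N : ℕ → ℕ := fun i => (boundedExponents s i).card with hN
  obtain ⟨c₁, hc₁⟩ := exists_mem_degreeLE z₁
  obtain ⟨c₂, hc₂⟩ := exists_mem_degreeLE z₂
  set c := max c₁ c₂
  replace hc₁ := degreeLE_mono (le_max_left c₁ c₂) hc₁
  replace hc₂ := degreeLE_mono (le_max_right c₁ c₂) hc₂
  -- In degrees at most `m` the free module maps onto `S/P`. Its kernel contains the multiples of
  -- the two independent relations, whose degrees are at most `c`, by coefficients of degree at most
  -- `m - c`.
  have hcount : ∀ m, (∑ j ∈ Finset.range (m + 1), hilbertFunction P j) +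
      (if c ≤ m then 2 * N (m - c) else 0) ≤
      ∑ j ∈ Finset.range (m + 1), hilbertFunction J j * N (m - j) := by
    intro m
    have hA : (restrictTotalDegree (Fin n) k m).map (Ideal.Quotient.mkₐ k P).toLinearMap ≤
        (degreeLE k s (hilbertFunction J) m).map
          ((Ideal.Quotient.mkₐ k P).toLinearMap.comp (presentation l e)) := by
      rintro _ ⟨f, hf, rfl⟩
      obtain ⟨_, ⟨v, hv, rfl⟩, g, hg, rfl⟩ := Submodule.mem_sup.1
        (mem_map_degreeLE hP hJ hl he hspan m f ((mem_restrictTotalDegree _ _ _).1 hf))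
      refine ⟨v, hv, ?_⟩
      rw [map_add]
      have hg0 : (Ideal.Quotient.mkₐ k P).toLinearMap g = 0 := Ideal.Quotient.eq_zero_iff_mem.2 hg
      rw [hg0, add_zero]
      rfl
    refine (Nat.add_le_add_right (sum_hilbertFunction_le hP m) _).trans
      (le_trans ?_ (finrank_degreeLE_le (k := k) (s := s) (a := hilbertFunction J) m))
    split_ifs with hcm
    · set V := restrictTotalDegree (Fin s) k (m - c) with hV
      have hmem : ∀ ρ ∈ V, ∀ z ∈ degreeLE k s (hilbertFunction J) c,
          ρ • z ∈ degreeLE k s (hilbertFunction J) m := by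
        intro ρ hρ z hz
        have := smul_mem_degreeLE ((mem_restrictTotalDegree _ _ _).1 hρ) hz
        rwa [Nat.add_sub_cancel' hcm] at this
      let θ : (V × V) →ₗ[k] ((Σ m, Fin (hilbertFunction J m)) →₀ MvPolynomial (Fin s) k) :=
        { toFun := fun p => p.1.1 • z₁ + p.2.1 • z₂
          map_add' := fun p q => by
            change (p.1.1 + q.1.1) • z₁ + (p.2.1 + q.2.1) • z₂ =
              (p.1.1 • z₁ + p.2.1 • z₂) + (q.1.1 • z₁ + q.2.1 • z₂)
            rw [add_smul, add_smul]
            abel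
          map_smul' := fun x p => by
            change (x • p.1.1) • z₁ + (x • p.2.1) • z₂ = x • (p.1.1 • z₁ + p.2.1 • z₂)
            rw [smul_add, smul_assoc, smul_assoc] }
      have hθ : Function.Injective θ := by
        refine (injective_iff_map_eq_zero _).2 fun p hp => ?_
        by_contra hne
        refine hind p.1.1 p.2.1 ?_ hp
        by_contra! h5
        exact hne (Prod.ext (Subtype.ext h5.1) (Subtype.ext h5.2))
      have h4 := finrank_add_le_of_le_map hA hθ
        (fun p => add_mem (hmem _ p.1.2 _ hc₁) (hmem _ p.2.2 _ hc₂))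
        (fun p => Ideal.Quotient.eq_zero_iff_mem.2 (mem_relations.1
          (add_mem (Submodule.smul_mem _ _ hz₁) (Submodule.smul_mem _ _ hz₂))))
      rwa [Module.finrank_prod, hV, finrank_restrictTotalDegree, ← two_mul] at h4
    · have h4 := finrank_add_le_of_le_map hA (θ := (0 : (Fin 0 → k) →ₗ[k] _))
        (fun _ _ _ => Subsingleton.elim _ _) (fun _ => zero_mem _) (fun _ => map_zero _)
      rwa [Module.finrank_fin_fun] at h4
  set NS : PowerSeries ℤ := PowerSeries.mk fun i => (N i : ℤ) with hNS
  set CP : PowerSeries ℤ :=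
    PowerSeries.mk fun m => ∑ j ∈ Finset.range (m + 1), (hilbertFunction P j : ℤ) with hCP
  have hNS1 : NS * (1 - PowerSeries.X) ^ (s + 1) = 1 := mk_card_boundedExponents_mul s
  have hCP1 : CP * (1 - PowerSeries.X) = hilbertSeries P := mk_sum_range_mul _
  -- The count as a series inequality. The exponent is `s + 1` because bounded degrees are counted,
  -- and the conclusion `G(1) ≥ 2` contradicts the hypothesis.
  have h := eval_one_nonneg_of_coeff_nonneg (G - 2 * Polynomial.X ^ c) (s + 1)
    (hilbertSeries J * NS - CP - 2 * (PowerSeries.X ^ c * NS)) ?_ ?_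
  · simp only [Polynomial.eval_sub, Polynomial.eval_mul, Polynomial.eval_pow, Polynomial.eval_X,
      one_pow, Polynomial.eval_ofNat] at h
    omega
  · rw [Polynomial.coe_sub, Polynomial.coe_mul, Polynomial.coe_pow, Polynomial.coe_X,
      show ((2 : Polynomial ℤ) : PowerSeries ℤ) = 2 from
        map_ofNat Polynomial.coeToPowerSeries.ringHom 2]
    linear_combination (hilbertSeries J - 2 * PowerSeries.X ^ c) * hNS1 -
      (1 - PowerSeries.X) ^ s * hCP1 + hG
  · intro m
    have h1 : PowerSeries.coeff m (hilbertSeries J * NS) =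
        ∑ j ∈ Finset.range (m + 1), (hilbertFunction J j : ℤ) * N (m - j) := by
      rw [PowerSeries.coeff_mul, Finset.Nat.sum_antidiagonal_eq_sum_range_succ_mk]
      simp [hilbertSeries, hNS]
    have h2 : PowerSeries.coeff m (2 * (PowerSeries.X ^ c * NS)) =
        if c ≤ m then 2 * (N (m - c) : ℤ) else 0 := by
      rw [two_mul, map_add, PowerSeries.coeff_X_pow_mul', hNS]
      split_ifs <;> simp [two_mul]
    rw [map_sub, map_sub, h1, h2, hCP, PowerSeries.coeff_mk]
    have h3 := hcount m
    zify at h3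
    simp only [Nat.cast_le] at h3
    linarith

/-- If the error term of the Hilbert series of `S / (P, l)` takes the value one at `1`, and the
last form is a zerodivisor modulo the previous ones, then the previous ones form a regular
sequence modulo `P`. -/
theorem mem_partialIdeal_of_mul_mem (hprime : P.IsPrime) (hP : IsHomogeneousIdeal P)
    (hl : ∀ i, (l i).IsHomogeneous 1)
    (hinj : ∀ f : MvPolynomial (Fin s) k, aeval l f ∈ P → f = 0)
    {G : Polynomial ℤ} (hG : hilbertSeries (partialIdeal P l s) =
      hilbertSeries P * (1 - PowerSeries.X) ^ s + (G : PowerSeries ℤ)) (hG1 : G.eval 1 < 2)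
    {t : Fin s} {h : MvPolynomial (Fin n) k} (hth : l t * h ∈ partialIdeal P l t.val)
    (hh : h ∉ partialIdeal P l t.val) (i : Fin s) (hi : i < t) {f : MvPolynomial (Fin n) k}
    (hf : l i * f ∈ partialIdeal P l i.val) : f ∈ partialIdeal P l i.val := by
  obtain ⟨e, he, hspan⟩ := exists_homogeneous_lifts (partialIdeal P l s)
  -- Saturation holds because `P` is prime and meets the polynomial ring in `l` trivially; `G(1) <
  -- 2` bounds the rank by one.
  obtain ⟨w, hw, hgen⟩ := exists_generator_of_saturated (Z := relations l e P)
    (fun ρ hρ v hv => by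
      rw [mem_relations, presentation_smul] at hv
      exact (hprime.mem_or_mem hv).resolve_left fun h => hρ (hinj ρ h))
    (fun v hv w hw => exists_relation_of_eval_lt_two hP partialIdeal_eq_sup_span_range.le hl he
      hspan hG hG1 hv hw)
  refine mem_partialIdeal_of_cyclic_relations (fun f => ?_) hw hgen hth hh i hi hf
  obtain ⟨_, ⟨v, -, rfl⟩, g, hg, rfl⟩ := Submodule.mem_sup.1
    (mem_map_degreeLE hP partialIdeal_eq_sup_span_range.le hl he hspan f.totalDegree f le_rfl)
  exact ⟨v, by rwa [add_sub_cancel_left]⟩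

end MinimalGenerators

/-! ### Regular sequences, `Ext` and depth -/

section Depth

open RingTheory.Sequence

lemma mk_mem_smul_top_iff {R : Type*} [CommRing R] (P I : Ideal R) (f : R) :
    (Submodule.Quotient.mk f : R ⧸ P) ∈ (I • ⊤ : Submodule R (R ⧸ P)) ↔ f ∈ P ⊔ I := by
  have h : (I • ⊤ : Submodule R (R ⧸ P)) = Submodule.map P.mkQ I := by
    rw [← Submodule.range_mkQ P, ← Submodule.map_top, ← Submodule.map_smul'', smul_eq_mul,
      Ideal.mul_top]
  rw [h, ← Submodule.comap_map_mkQ P I]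
  rfl

lemma smul_top_eq_top_iff {R : Type*} [CommRing R] (P I : Ideal R) :
    (I • ⊤ : Submodule R (R ⧸ P)) = ⊤ ↔ P ⊔ I = ⊤ := by
  rw [Ideal.eq_top_iff_one, ← mk_mem_smul_top_iff]
  refine ⟨fun h => by rw [h]; exact Submodule.mem_top, fun h => eq_top_iff.2 ?_⟩
  rintro x -
  obtain ⟨f, rfl⟩ := Submodule.Quotient.mk_surjective P x
  have := Submodule.smul_mem _ f h
  rwa [← Submodule.Quotient.mk_smul, smul_eq_mul, mul_one] at this

lemma isWeaklyRegular_quotient_iff {R : Type*} [CommRing R] (P : Ideal R) (rs : List R) :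
    IsWeaklyRegular (R ⧸ P) rs ↔ ∀ i (h : i < rs.length), ∀ f,
      rs[i] * f ∈ P ⊔ Ideal.ofList (rs.take i) → f ∈ P ⊔ Ideal.ofList (rs.take i) := by
  rw [isWeaklyRegular_iff]
  refine forall₂_congr fun i hi => ?_
  rw [isSMulRegular_quotient_iff_mem_of_smul_mem,
    (Submodule.Quotient.mk_surjective P).forall]
  refine forall_congr' fun f => ?_
  rw [← Submodule.Quotient.mk_smul, mk_mem_smul_top_iff, mk_mem_smul_top_iff, smul_eq_mul]

lemma sup_ofList_take_ofFn {R : Type*} [CommRing R] (P : Ideal R) {t : ℕ} (l : Fin t → R)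
    (i : ℕ) : P ⊔ Ideal.ofList ((List.ofFn l).take i) = partialIdeal P l i := by
  rw [partialIdeal, Ideal.ofList]
  congr 2
  ext f
  change f ∈ (List.ofFn l).take i ↔ _
  rw [List.mem_take_iff_getElem]
  constructor
  · rintro ⟨j, hj, rfl⟩
    rw [List.length_ofFn, lt_min_iff] at hj
    exact ⟨⟨j, hj.2⟩, hj.1, by rw [List.getElem_ofFn]⟩
  · rintro ⟨p, hp, rfl⟩
    exact ⟨p.1, by rw [List.length_ofFn]; exact lt_min hp p.2, by rw [List.getElem_ofFn]⟩

lemma partialIdeal_castLE {R : Type*} [CommRing R] (P : Ideal R) {t s : ℕ} (h : t ≤ s)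
    (l : Fin s → R) {i : ℕ} (hi : i ≤ t) :
    partialIdeal P (fun p : Fin t => l (Fin.castLE h p)) i = partialIdeal P l i := by
  rw [partialIdeal, partialIdeal]
  congr 2
  ext f
  exact ⟨fun ⟨p, hp, hf⟩ => ⟨Fin.castLE h p, hp, hf⟩,
    fun ⟨p, hp, hf⟩ => ⟨⟨p.1, hp.trans_le hi⟩, hp, hf⟩⟩

lemma isRegular_ofFn {R : Type*} [CommRing R] {P : Ideal R} {t : ℕ} {l : Fin t → R}
    (hreg : ∀ i : Fin t, ∀ f, l i * f ∈ partialIdeal P l i.val → f ∈ partialIdeal P l i.val)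
    (hne : partialIdeal P l t ≠ ⊤) : IsRegular (R ⧸ P) (List.ofFn l) := by
  refine (isRegular_iff _ _).2 ⟨(isWeaklyRegular_quotient_iff _ _).2 fun i hi f hf => ?_, ?_⟩
  · rw [sup_ofList_take_ofFn, List.getElem_ofFn] at *
    rw [List.length_ofFn] at hi
    exact hreg ⟨i, hi⟩ f hf
  · rw [ne_comm, Ne, smul_top_eq_top_iff]
    rw [← sup_ofList_take_ofFn, List.take_of_length_le (by simp)] at hne
    exact hne

open CategoryTheory Abelian in
/-- Vanishing of `Ext` passes to the quotient by a regular sequence, with a shift. -/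
lemma subsingleton_ext_partialIdeal {R : Type*} [CommRing R] {P : Ideal R} {t : ℕ} {l : Fin t → R}
    (hreg : ∀ i : Fin t, ∀ f, l i * f ∈ partialIdeal P l i.val → f ∈ partialIdeal P l i.val)
    (N : ModuleCat R) {p : ℕ}
    (hN : ∀ j < p, Subsingleton (Ext N (ModuleCat.of R (R ⧸ P)) j)) (i : ℕ) (hi : i ≤ t) (j : ℕ)
    (hj : i + j < p) : Subsingleton (Ext N (ModuleCat.of R (R ⧸ partialIdeal P l i)) j) := by
  induction i generalizing j with
  | zero =>
    rw [partialIdeal_zero]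
    exact hN j (by omega)
  | succ i ih =>
    set J := partialIdeal P l i
    set J' := partialIdeal P l (i + 1)
    set x := l ⟨i, hi⟩
    have hJ' : J' = J ⊔ Ideal.span {x} := partialIdeal_succ P l ⟨i, hi⟩
    have hle : J ≤ J' := hJ' ▸ le_sup_left
    let φ : (R ⧸ J) →ₗ[R] (R ⧸ J) := LinearMap.lsmul R (R ⧸ J) x
    let π : (R ⧸ J) →ₗ[R] (R ⧸ J') := Submodule.factor hle
    have hex : Function.Exact φ π := by
      intro y
      obtain ⟨f, rfl⟩ := Submodule.Quotient.mk_surjective J y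
      change (Submodule.Quotient.mk f : R ⧸ J') = 0 ↔ _
      rw [Submodule.Quotient.mk_eq_zero]
      constructor
      · intro hf
        rw [hJ'] at hf
        obtain ⟨u, hu, v, hv, rfl⟩ := Submodule.mem_sup.1 hf
        obtain ⟨g, rfl⟩ := Ideal.mem_span_singleton'.1 hv
        refine ⟨Submodule.Quotient.mk g, ?_⟩
        change x • (Submodule.Quotient.mk g : R ⧸ J) = _
        rw [← Submodule.Quotient.mk_smul, Submodule.Quotient.eq, smul_eq_mul]
        convert J.neg_mem hu using 1
        ring
      · rintro ⟨z, hz⟩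
        obtain ⟨g, rfl⟩ := Submodule.Quotient.mk_surjective J z
        change x • (Submodule.Quotient.mk g : R ⧸ J) = _ at hz
        rw [← Submodule.Quotient.mk_smul, Submodule.Quotient.eq, smul_eq_mul] at hz
        have hx : x * g ∈ J' := hJ' ▸ Ideal.mem_sup_right
          (Ideal.mul_mem_right _ _ (Ideal.mem_span_singleton_self _))
        have := sub_mem hx (hle hz)
        rwa [sub_sub_cancel] at this
    have hinj : Function.Injective φ := by
      refine (injective_iff_map_eq_zero φ).2 fun y hy => ?_
      obtain ⟨f, rfl⟩ := Submodule.Quotient.mk_surjective J y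
      change x • (Submodule.Quotient.mk f : R ⧸ J) = 0 at hy
      rw [← Submodule.Quotient.mk_smul, Submodule.Quotient.mk_eq_zero, smul_eq_mul] at hy
      rw [Submodule.Quotient.mk_eq_zero]
      exact hreg ⟨i, hi⟩ f hy
    let T := ModuleCat.shortComplexOfCompEqZero φ π hex.linearMap_comp_eq_zero
    have hT : T.ShortExact :=
      { exact := ModuleCat.shortComplex_exact _ hex
        mono_f := (ModuleCat.mono_iff_injective _).2 hinj
        epi_g := (ModuleCat.epi_iff_surjective _).2 (Submodule.factor_surjective hle) }
    have zero1 := AddCommGrpCat.isZero_of_iff_subsingleton.mpr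
      (ih (Nat.le_of_succ_le hi) j (by omega))
    have zero2 := AddCommGrpCat.isZero_of_iff_subsingleton.mpr
      (ih (Nat.le_of_succ_le hi) (j + 1) (by omega))
    -- In the long exact sequence of `0 → R/J → R/J → R/J' → 0`, the term for `R/J'` in degree `j`
    -- lies between those for `R/J` in degrees `j` and `j + 1`, so each step costs one degree.
    exact AddCommGrpCat.subsingleton_of_isZero <| ShortComplex.Exact.isZero_of_both_zeros
      ((Ext.covariant_sequence_exact₃' N hT) j (j + 1) rfl)
      (zero1.eq_zero_of_src _) (zero2.eq_zero_of_tgt _)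

open CategoryTheory Abelian in
/-- A regular sequence in `I` is at most as long as one modulo which there is `I`-torsion. -/
theorem length_le_of_torsion {R : Type*} [CommRing R] [IsNoetherianRing R] {P I : Ideal R} {t : ℕ}
    {l : Fin t → R}
    (hreg : ∀ i : Fin t, ∀ f, l i * f ∈ partialIdeal P l i.val → f ∈ partialIdeal P l i.val)
    (hPI : P ⊔ I ≠ ⊤) {h : R} (hh : h ∉ partialIdeal P l t)
    (htor : ∀ x ∈ I, ∃ N : ℕ, x ^ N * h ∈ partialIdeal P l t) {rs : List R}
    (hrs : IsRegular (R ⧸ P) rs) (hmem : ∀ f ∈ rs, f ∈ I) : rs.length ≤ t := by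
  by_contra! hlt
  set J := partialIdeal P l t
  set y : R ⧸ J := Submodule.Quotient.mk h
  set U := Submodule.span R {y}
  -- Since `U` is supported on `V(I)`, a regular sequence in `I` longer than `t` kills `Ext^j(U,
  -- R/P)` for `j ≤ t`. Shifting by `t` gives `Hom(U, R/J) = 0`, contradicted by the inclusion of
  -- `U`.
  have hU : Module.support R U ⊆ PrimeSpectrum.zeroLocus I := by
    rw [Module.support_eq_zeroLocus, PrimeSpectrum.zeroLocus_subset_zeroLocus_iff]
    intro x hx
    obtain ⟨N, hN⟩ := htor x hx
    refine ⟨N, (Submodule.mem_annihilator_span_singleton y (x ^ N)).2 ?_⟩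
    rwa [← Submodule.Quotient.mk_smul, Submodule.Quotient.mk_eq_zero, smul_eq_mul]
  have hext := ModuleCat.subsingleton_ext_of_exists_isRegular I (ModuleCat.of R U) hU
    (ModuleCat.of R (R ⧸ P)) (lt_top_iff_ne_top.2 fun h => hPI ((smul_top_eq_top_iff P I).1 h))
    rs hmem hrs
  have h0 := subsingleton_ext_partialIdeal hreg (ModuleCat.of R U) hext t le_rfl 0 (by omega)
  have h1 : Subsingleton (U →ₗ[R] R ⧸ J) :=
    ((Ext.addEquiv₀ (X := ModuleCat.of R U) (Y := ModuleCat.of R (R ⧸ J))).trans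
      ModuleCat.homAddEquiv).symm.subsingleton
  have h2 := LinearMap.congr_fun (Subsingleton.elim U.subtype 0)
    (⟨y, Submodule.mem_span_singleton_self y⟩ : U)
  exact hh ((Submodule.Quotient.mk_eq_zero J).1 h2)

lemma IsHomogeneousIdeal.le_idealOfVars {n : ℕ} {P : Ideal (MvPolynomial (Fin n) k)}
    (hP : IsHomogeneousIdeal P) (hne : P ≠ ⊤) : P ≤ idealOfVars (Fin n) k := by
  intro f hf
  have h1 := isHomogeneousIdeal_iff.1 hP f hf 0
  rw [homogeneousComponent_zero] at h1
  have h2 : coeff 0 f = 0 := by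
    by_contra h0
    exact hne (Ideal.eq_top_of_isUnit_mem _ h1 ((isUnit_iff_ne_zero.2 h0).map C))
  rw [← pow_one (idealOfVars (Fin n) k), mem_pow_idealOfVars_iff']
  intro x hx
  rw [(Finsupp.degree_eq_zero_iff x).1 (by omega), h2]

lemma idealOfVars_ne_top (n : ℕ) : idealOfVars (Fin n) k ≠ ⊤ := by
  rw [Ne, Ideal.eq_top_iff_one, ← pow_one (idealOfVars (Fin n) k), mem_pow_idealOfVars_iff']
  intro h
  simpa using h 0 (by simp)

/-- The depth is computed by a regular sequence of linear forms modulo which there is a nonzero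
torsion element. -/
theorem depthQuotient_eq {n t : ℕ} {P : Ideal (MvPolynomial (Fin n) k)}
    (hP : IsHomogeneousIdeal P) (hne : P ≠ ⊤) {l : Fin t → MvPolynomial (Fin n) k}
    (hl : ∀ i, (l i).IsHomogeneous 1)
    (hreg : ∀ i : Fin t, ∀ f, l i * f ∈ partialIdeal P l i.val → f ∈ partialIdeal P l i.val)
    {h : MvPolynomial (Fin n) k} (hh : h ∉ partialIdeal P l t)
    (htor : ∀ j, ∃ N : ℕ, X j ^ N * h ∈ partialIdeal P l t) : depthQuotient P = t := by
  apply le_antisymm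
  · refine iSup_le fun ⟨rs, hrs, hmem⟩ => Nat.cast_le.2 ?_
    refine length_le_of_torsion hreg (I := idealOfVars (Fin n) k) ?_ hh ?_ hrs hmem
    · rw [sup_eq_right.2 (hP.le_idealOfVars hne)]
      exact idealOfVars_ne_top n
    · intro x hx
      suffices H : idealOfVars (Fin n) k ≤ ((partialIdeal P l t).colon {h}).radical by
        obtain ⟨N, hN⟩ := H hx
        exact ⟨N, Submodule.mem_colon_singleton.1 hN⟩
      refine Ideal.span_le.2 ?_
      rintro _ ⟨j, rfl⟩
      obtain ⟨N, hN⟩ := htor j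
      exact ⟨N, Submodule.mem_colon_singleton.2 hN⟩
  · have hR := isRegular_ofFn hreg (partialIdeal_ne_top hP hne hl t)
    refine le_iSup_of_le ⟨List.ofFn l, hR, fun f hf => ?_⟩ (by simp)
    obtain ⟨i, rfl⟩ := (List.mem_ofFn' _ _).1 hf
    rw [← pow_one (idealOfVars (Fin n) k)]
    exact isHomogeneous_mem_pow_idealOfVars (hl i) le_rfl

end Depth

/-! ### General position and the final computation -/

section General

variable {s n : ℕ}

lemma forGeneralLinearForms_of_eval_ne_zero [Infinite k]
    {Q : (Fin s → MvPolynomial (Fin n) k) → Prop} {F : MvPolynomial (Fin s × Fin n) k}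
    (hF : F ≠ 0) (hQ : ∀ a : Fin s → Fin n → k, eval (fun p => a p.1 p.2) F ≠ 0 →
      Q (fun j => linearForm (a j))) : ForGeneralLinearForms s n Q := by
  refine ⟨{a | eval (fun p => a p.1 p.2) F ≠ 0}, ⟨{F}, by simp⟩, ?_, hQ⟩
  by_contra hempty
  apply hF
  apply MvPolynomial.funext
  intro x
  by_contra hx
  rw [map_zero] at hx
  exact hempty ⟨fun i j => x (i, j), hx⟩

/-- The Hilbert coefficients of a general linear section, and the depth in the extremal case. -/
theorem hilbertCoeff_partialIdeal [Infinite k] {t d : ℕ} {P : Ideal (MvPolynomial (Fin n) k)}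
    (hprime : P.IsPrime) (hP : IsHomogeneousIdeal P)
    (hd : ringKrullDim (MvPolynomial (Fin n) k ⧸ P) = d) (htd : t + 1 ≤ d)
    {l : Fin (t + 1) → MvPolynomial (Fin n) k} (hl : ∀ i, (l i).IsHomogeneous 1)
    (hreg : IsFilterRegular P l) :
    (∀ i < d - (t + 1), hilbertCoeff P i = hilbertCoeff (partialIdeal P l (t + 1)) i) ∧
    (hilbertCoeff P (d - (t + 1)) = hilbertCoeff (partialIdeal P l (t + 1)) (d - (t + 1)) -
      (-1) ^ (d - (t + 1)) → depthQuotient P = t) := by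
  have hne := hprime.ne_top
  obtain ⟨G, hG, hG1⟩ := exists_hilbertSeries_partialIdeal hP hl hreg (Fin.last t)
  rw [Fin.val_last] at hG hG1
  obtain ⟨hdim, hinj⟩ := ringKrullDim_partialIdeal hP hne hl hd htd hG
  obtain ⟨q, hq⟩ := exists_hilbertSeries_numerator hP hne hd
  have hnum : hilbertNumerator (partialIdeal P l (t + 1)) =
      q + G * (1 - Polynomial.X) ^ (d - (t + 1)) := by
    refine hilbertNumerator_eq hdim ?_
    push_cast
    rw [hq, hG, add_mul, mul_assoc, ← pow_add, Nat.add_sub_cancel' htd]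
  have hcoeff : ∀ i ≤ d - (t + 1), hilbertCoeff (partialIdeal P l (t + 1)) i =
      hilbertCoeff P i + if i = d - (t + 1) then (-1) ^ (d - (t + 1)) * G.eval 1 else 0 := by
    intro i hi
    rw [hilbertCoeff, hilbertCoeff, hnum, hilbertNumerator_eq hd hq, taylor_coeff_add _ _ _ _ hi]
  refine ⟨fun i hi => ?_, fun h => ?_⟩
  · rw [hcoeff i hi.le, if_neg hi.ne, add_zero]
  · rw [hcoeff _ le_rfl, if_pos rfl] at h
    -- The prescribed jump of the coefficient is exactly `(-1)^(d-s) G(1)` with `G(1) = 1`. Being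
    -- nonzero, it yields `f` killed by the last form; being less than two, it makes the first `t`
    -- forms regular.
    have hone : G.eval 1 = 1 := by
      have h1 : (-1 : ℤ) ^ (d - (t + 1)) * G.eval 1 = (-1) ^ (d - (t + 1)) * 1 := by linarith
      exact mul_left_cancel₀ (pow_ne_zero _ (by norm_num)) h1
    obtain ⟨f, hf, hfJ⟩ := hG1 (by rw [hone]; norm_num)
    set l' : Fin t → MvPolynomial (Fin n) k := fun p => l (Fin.castLE t.le_succ p)
    have hJ : ∀ i ≤ t, partialIdeal P l' i = partialIdeal P l i := fun i hi =>
      partialIdeal_castLE P t.le_succ l hi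
    refine depthQuotient_eq (l := l') hP hne (fun i => hl _) (fun i g hg => ?_)
      (h := f) (by rwa [hJ t le_rfl]) (fun j => ?_)
    · rw [hJ i.val i.2.le] at hg ⊢
      exact mem_partialIdeal_of_mul_mem hprime hP hl hinj hG (by rw [hone]; norm_num)
        (t := Fin.last t) hf hfJ (Fin.castLE t.le_succ i) i.2 hg
    · rw [hJ t le_rfl]
      exact hreg (Fin.last t) f hf j

end General

lemma hilbertCoeff_congr {n r : ℕ} {I : Ideal (MvPolynomial (Fin n) k)}
    {J : Ideal (MvPolynomial (Fin r) k)} (h : ∀ m, hilbertFunction I m = hilbertFunction J m)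
    (hd : ringKrullDim (MvPolynomial (Fin n) k ⧸ I) = ringKrullDim (MvPolynomial (Fin r) k ⧸ J))
    (i : ℕ) : hilbertCoeff I i = hilbertCoeff J i := by
  have hs : hilbertSeries I = hilbertSeries J := by
    ext m
    simp [hilbertSeries, h]
  have hq : quotientDim I = quotientDim J := by rw [quotientDim, quotientDim, hd]
  have hH : hilbertSeries I * (1 - PowerSeries.X) ^ quotientDim I =
      hilbertSeries J * (1 - PowerSeries.X) ^ quotientDim J := by rw [hs, hq]
  unfold hilbertCoeff hilbertNumerator
  generalize hilbertSeries I * (1 - PowerSeries.X) ^ quotientDim I = H at hH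
  subst hH
  rfl

end HilbertDepth

end

theorem theorem5p4 {k : Type*} [Field k] [Infinite k] (r s d : ℕ)
    (P : Ideal (MvPolynomial (Fin (r + s)) k)) (hP : P.IsPrime)
    (hhom : HilbertDepth.IsHomogeneousIdeal P)
    (hd : ringKrullDim (MvPolynomial (Fin (r + s)) k ⧸ P) = d)
    (hs : 1 ≤ s) (hsd : s ≤ d) :
    HilbertDepth.ForGeneralLinearForms s (r + s)
      (fun l : Fin s → MvPolynomial (Fin (r + s)) k =>
        HilbertDepth.IterProjDefined s r l ∧
        (∀ i : ℕ, i < d - s →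
          HilbertDepth.hilbertCoeff P i =
            HilbertDepth.hilbertCoeff (P.map (HilbertDepth.iterProj s r l)) i) ∧
        (HilbertDepth.hilbertCoeff P (d - s) =
            HilbertDepth.hilbertCoeff (P.map (HilbertDepth.iterProj s r l)) (d - s)
              - (-1) ^ (d - s) →
          HilbertDepth.depthQuotient P = ((s - 1 : ℕ) : ℕ∞))) := by
  obtain ⟨t, rfl⟩ := Nat.exists_eq_add_of_le' hs
  obtain ⟨F₁, hF₁, h₁⟩ := HilbertDepth.exists_forall_isFilterRegular hP (t + 1)
  obtain ⟨F₂, hF₂, h₂⟩ := HilbertDepth.exists_forall_iterProjDefined (k := k) (t + 1) r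
  -- Nonvanishing of the product imposes both open conditions at once.
  refine HilbertDepth.forGeneralLinearForms_of_eval_ne_zero (mul_ne_zero hF₁ hF₂) fun a ha => ?_
  rw [map_mul] at ha
  have hreg := h₁ a (left_ne_zero_of_mul ha)
  have hdef := h₂ a (right_ne_zero_of_mul ha)
  set l := fun j => HilbertDepth.linearForm (a j)
  have hl : ∀ i, (l i).IsHomogeneous 1 := fun i => HilbertDepth.isHomogeneous_linearForm (a i)
  have hJ : HilbertDepth.partialIdeal P l (t + 1) =
      P ⊔ RingHom.ker (HilbertDepth.iterProj (t + 1) r l) := by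
    rw [HilbertDepth.ker_iterProj _ _ l hl hdef, HilbertDepth.partialIdeal_eq_sup_span_range]
  have hsurj := HilbertDepth.iterProj_surjective (t + 1) r l
  have hcoeff : ∀ i, HilbertDepth.hilbertCoeff (P.map (HilbertDepth.iterProj (t + 1) r l)) i =
      HilbertDepth.hilbertCoeff (HilbertDepth.partialIdeal P l (t + 1)) i := by
    rw [hJ]
    exact HilbertDepth.hilbertCoeff_congr (HilbertDepth.hilbertFunction_map hsurj
      (HilbertDepth.isHomogeneous_iterProj_X (t + 1) r l) P)
      (HilbertDepth.ringKrullDim_quotient_map hsurj P)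
  obtain ⟨h1, h2⟩ := HilbertDepth.hilbertCoeff_partialIdeal hP hhom hd hsd hl hreg
  exact ⟨hdef, fun i hi => by rw [hcoeff]; exact h1 i hi, fun h => h2 (by rwa [hcoeff] at h)⟩
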